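/- **The game.** Let $p,q>0$ with $p+q\le 1$, and $\gamma>0$. Individuals $1,\dots,n$ form a simple undirected graph $E$ on $[n]$; write $N_i(E)$ for the set of neighbours and $d_i$ for the degree of $i$. Independently, individual $i$ receives $X_i$ exogenous opportunities, where $X_i=0,1,2$ with probability $q$, $1-p-q$, $p$. An individual with $X_j=2$ and at least one neighbour passes one opportunity to a neighbour chosen uniformly at random, independently of everything else; let $R_{ji}\in\{0,1\}$ indicate that $j$ passes an opportunity to $i$. The expected utility of $i$ is $$u_i(E)=\mathbb E\Big[\min\Big\{1,\;X_i+\sum_{j\in N_i(E)}R_{ji}\Big\}\Big]-\gamma d_i .$$ A graph $E$ is a *defection-free pairwise Nash equilibrium* if (1) for all $i\ne j$ with $(i,j)\notin E$ and all $S_i\subseteq N_i(E)$, $S_j\subseteq N_j(E)$, $$u_i\big(E\cup\{(i,j)\}\setminus\{(i,\ell):\ell\in S_i\}\big)\le u_i(E)\quad\text{or}\quad u_j\big(E\cup\{(i,j)\}\setminus\{(j,\ell):\ell\in S_j\}\big)\le u_j(E);$$ and (2) for all $(i,j)\in E$, $u_i(E\setminus\{(i,j)\})\le u_i(E)$ and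 $u_j(E\setminus\{(i,j)\})\le u_j(E)$. The *price of anarchy* is $$\mathrm{PoA}(n,q,p,\gamma)=\frac{\max_E\sum_{i}u_i(E)}{\min_{E\text{ equilibrium}}\sum_{i}u_i(E)} .$$ **Theorem.** Fix $p,q>0$ with $p+q\le1$. (a) Let $0<\gamma\le qp$. There is a largest positive integer $d$ with $$\frac{\gamma}{qp}\le\frac1d\Big(1-\frac pd\Big)^{d-1}.$$ Equilibria exist for all sufficiently large $n$. For $\delta_1,\delta_2\in[0,1]$ put $$f(\delta_1,\delta_2)=\frac{1-q(1-p)-\gamma}{1-q\left(1-\frac{p}{d+\delta_1+\delta_2}\right)^{d+\delta_1}-\gamma(d+\delta_1)},$$ read as $+\infty$ where the denominator is not positive (the numerator is always positive). Then $f$ attains a minimum and a maximum in $(0,+\infty]$ over $[0,1]^2$, and there is a sequence $\varepsilon_n\to0$ (depending on $p,q,\gamma$) such that for all sufficiently large $n$ $$\min_{\delta_1,\delta_2\in[0,1]}f(\delta_1,\delta_2)\;\le\;\mathrm{PoA}(n,q,p,\gamma)+\varepsilon_n\;\le\;\max_{\delta_1,\delta_2\in[0,1]}f(\delta_1,\delta_2).$$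 (b) If $\gamma>qp$, then $\mathrm{PoA}(n,q,p,\gamma)=1$ for every $n\ge1$. -/

import Mathlib

open Filter Topology

namespace ProfessionalNetworking

/-- The law of the number of exogenous opportunities of one individual: `0` with probability `q`,
`1` with probability `1 - p - q`, and `2` with probability `p`. -/
def exogProb (q p : ℝ) : Fin 3 → ℝ := ![q, 1 - p - q, p]

section Network

variable {V : Type*} [Fintype V]

open Classical in
/-- The law of the contact to whom individual `j` would pass an extra opportunity: uniform on the
neighbours of `j`, and nobody (`none`) if `j` has no neighbour. -/
noncomputable def targetProb (G : SimpleGraph V) (j : V) : Option V → ℝ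
  | none => if G.degree j = 0 then 1 else 0
  | some k => if G.Adj j k then 1 / (G.degree j : ℝ) else 0

open Classical in
/-- The indicator that `j` passes an opportunity to `i`, when `x` lists the numbers of exogenous
opportunities and `t` the contacts drawn by the individuals. -/
noncomputable def transfer (x : V → Fin 3) (t : V → Option V) (j i : V) : ℝ :=
  if x j = 2 ∧ t j = some i then 1 else 0

open Classical in
/-- Realized utility of `i`: the opportunity used (at most one) minus the connection costs. -/
noncomputable def realizedUtility (γ : ℝ) (G : SimpleGraph V) (i : V)
    (x : V → Fin 3) (t : V → Option V) : ℝ :=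
  min 1 (((x i : ℕ) : ℝ) + ∑ j ∈ G.neighborFinset i, transfer x t j i) - γ * (G.degree i : ℝ)

open Classical in
/-- Expected utility of `i` on the network `G`. All the numbers of exogenous opportunities and all
the drawn contacts are independent; the expectation is the sum over all joint outcomes. -/
noncomputable def utility (q p γ : ℝ) (G : SimpleGraph V) (i : V) : ℝ :=
  ∑ x : V → Fin 3, ∑ t : V → Option V,
    (∏ j, exogProb q p (x j) * targetProb G j (t j)) * realizedUtility γ G i x t

/-- Social welfare: the sum of the expected utilities. -/
noncomputable def welfare (q p γ : ℝ) (G : SimpleGraph V) : ℝ :=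
  ∑ i, utility q p γ G i

/-- The network obtained from `G` by forming the connection `ij` and deleting the connections of `i`
to the members of `S`. -/
def addAndDrop (G : SimpleGraph V) (i j : V) (S : Set V) : SimpleGraph V :=
  (G ⊔ SimpleGraph.edge i j).deleteEdges {e | ∃ l ∈ S, e = s(i, l)}

/-- Defection-free pairwise Nash equilibrium. -/
def IsDFPNE (q p γ : ℝ) (G : SimpleGraph V) : Prop :=
  (∀ i j : V, i ≠ j → ¬ G.Adj i j →
    ∀ Si ⊆ G.neighborSet i, ∀ Sj ⊆ G.neighborSet j,
      utility q p γ (addAndDrop G i j Si) i ≤ utility q p γ G i ∨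
      utility q p γ (addAndDrop G j i Sj) j ≤ utility q p γ G j) ∧
  (∀ i j : V, G.Adj i j →
    utility q p γ (G.deleteEdges {s(i, j)}) i ≤ utility q p γ G i ∧
    utility q p γ (G.deleteEdges {s(i, j)}) j ≤ utility q p γ G j)

end Network

/-- The price of anarchy with `n` individuals: the optimal social welfare divided by the least
social welfare of an equilibrium (both extrema are over finite sets). -/
noncomputable def PoA (n : ℕ) (q p γ : ℝ) : ℝ :=
  sSup (Set.range fun G : SimpleGraph (Fin n) => welfare q p γ G) /
    sInf {w : ℝ | ∃ G : SimpleGraph (Fin n), IsDFPNE q p γ G ∧ w = welfare q p γ G}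

/-- `a` lies between the minimum and the maximum of `f` over the unit square. -/
def EqDelta (a : EReal) (f : ℝ → ℝ → EReal) : Prop :=
  ∃ m M : EReal,
    IsLeast {y | ∃ δ₁ ∈ Set.Icc (0 : ℝ) 1, ∃ δ₂ ∈ Set.Icc (0 : ℝ) 1, y = f δ₁ δ₂} m ∧
    IsGreatest {y | ∃ δ₁ ∈ Set.Icc (0 : ℝ) 1, ∃ δ₂ ∈ Set.Icc (0 : ℝ) 1, y = f δ₁ δ₂} M ∧
    m ≤ a ∧ a ≤ M

/-- The quotient `a / b` of a positive number `a` by `b`, read as `+∞` when `b` is not positive. -/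
noncomputable def extQuot (a b : ℝ) : EReal :=
  if 0 < b then ((a / b : ℝ) : EReal) else ⊤

/-- The asymptotic expression for the price of anarchy. -/
noncomputable def poaExpr (q p γ : ℝ) (d : ℕ) (δ₁ δ₂ : ℝ) : EReal :=
  extQuot (1 - q * (1 - p) - γ)
    (1 - q * (1 - p / (d + δ₁ + δ₂)) ^ ((d : ℝ) + δ₁) - γ * (d + δ₁))

end ProfessionalNetworking

/-!
An individual `i` gets nothing iff it has no exogenous opportunity and none of its neighbours passes
one on; these events are independent, so its expected utility is
`1 - q * ∏ (1 - p / degree j) - γ * degree i`, the product over the neighbours `j` of `i`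
(`utility_eq`). Hence the value of a set of connections is submodular, and being an equilibrium is a
local matter: it suffices that each single connection is worth its cost, and that no two individuals
without a connection both want one, where `i` wants `j` if it gains by adding `j`, or by exchanging
one neighbour for `j` (`isDFPNE_of_local`).

*The optimum.* Each individual with a neighbour adds at most `q * p - γ` to the welfare of the empty
network (`welfare_le_sum`). So for `γ > q * p` the empty network is optimal, and it is the only
equilibrium; for `γ ≤ q * p` a perfect matching, up to one individual, is optimal up to a bounded
amount (`exists_welfare_near_optimal`).

*A nearly regular equilibrium.* A `d`-regular network is an equilibrium, because
`linkValue p` is decreasing and `d` is the largest degree at which a connection is worth its cost.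
When `n * d` is odd, a bounded modification of such a network is an equilibrium
(`exists_isDFPNE`). Its welfare is `n * baseUtility q p γ d 0 0` up to a bounded amount, which bounds
the price of anarchy from below.

*Every equilibrium.* Individuals who want each other are adjacent, and degrees are bounded, so any
set of individuals who all want each other has bounded size. This applies to the individuals with a
neighbour whose degree exceeds their own by two or more (`swappers`), and to those of degree less
than `d` for whom one more neighbour of degree `d` is worth its cost (`seekers`). It follows, by
downward induction on the degree, that the number of individuals of degree at least `d + 2` is
bounded (`exists_card_degreeGE_le`): if `i` is of degree `k ≥ d + 2` and has no neighbour of larger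
degree, then one of its neighbours has degree at most `k - 2`, since otherwise a connection in a
`k`-regular or `(k - 1)`-regular network would be worth its cost. The remaining individuals have
degree less than `d` and are not seekers, or have degree `d` or `d + 1` and only neighbours whose
degree is at most one larger; their utilities are at least `baseUtility q p γ d δ₁ δ₂` with
`(δ₁, δ₂)` equal to `(0, 0)`, `(0, 1)`, `(1, 1)` respectively. So the welfare of every equilibrium is
at least `n` times the minimum of `baseUtility` up to a bounded amount
(`exists_le_welfare_of_isDFPNE`), which bounds the price of anarchy from above.
-/

namespace ProfessionalNetworking

/-! ### Expected utility -/

section Utility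

open scoped Classical

variable {V : Type*} [Fintype V]

/-- The probability that none of the neighbours of `i` passes an opportunity to `i`. -/
noncomputable def missProb (p : ℝ) (G : SimpleGraph V) (i : V) : ℝ :=
  ∏ j ∈ G.neighborFinset i, (1 - p / (G.degree j : ℝ))

lemma sum_targetProb (G : SimpleGraph V) (j : V) : ∑ t, targetProb G j t = 1 := by
  rw [Fintype.sum_option]
  simp only [targetProb]
  rw [← Finset.sum_filter, Finset.sum_const, nsmul_eq_mul, ← G.neighborFinset_eq_filter,
    G.card_neighborFinset_eq_degree]
  by_cases h : G.degree j = 0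
  · simp [h]
  · rw [if_neg h, zero_add, mul_one_div_cancel (by exact_mod_cast h)]

lemma sum_exogProb (q p : ℝ) : ∑ a, exogProb q p a = 1 := by
  simp [exogProb, Fin.sum_univ_three]

/-- The event that `i` gets no opportunity is an intersection of events, one for each individual
`j`, that depend only on the outcome `(a, t)` of `j`; this is the indicator of the event for `j`. -/
noncomputable def missIndicator (G : SimpleGraph V) (i j : V) (a : Fin 3) (t : Option V) : ℝ :=
  if j = i then (if a = 0 then 1 else 0)
  else if G.Adj i j then 1 - (if a = 2 ∧ t = some i then 1 else 0) else 1

lemma min_one_opportunities (G : SimpleGraph V) (i : V) (x : V → Fin 3) (t : V → Option V) :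
    min 1 (((x i : ℕ) : ℝ) + ∑ j ∈ G.neighborFinset i, transfer x t j i) =
      1 - ∏ j, missIndicator G i j (x j) (t j) := by
  have hnn : ∀ j ∈ G.neighborFinset i, 0 ≤ transfer x t j i := by
    intro j _; unfold transfer; split_ifs <;> norm_num
  by_cases hx : x i = 0
  · by_cases ht : ∃ j, G.Adj i j ∧ x j = 2 ∧ t j = some i
    · obtain ⟨j, hij, hj⟩ := ht
      have h1 : 1 ≤ ∑ j ∈ G.neighborFinset i, transfer x t j i := by
        refine le_trans ?_ (Finset.single_le_sum hnn ((G.mem_neighborFinset i j).2 hij))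
        simp [transfer, hj]
      rw [Finset.prod_eq_zero (Finset.mem_univ j)
        (by simp [missIndicator, hij.ne', hij, hj]), sub_zero, min_eq_left]
      simpa [hx] using h1
    · push Not at ht
      have h0 : ∑ j ∈ G.neighborFinset i, transfer x t j i = 0 := by
        refine Finset.sum_eq_zero fun j hj => ?_
        rw [G.mem_neighborFinset] at hj
        simp only [transfer]
        rw [if_neg fun h => ht j hj h.1 h.2]
      have h1 : ∏ j, missIndicator G i j (x j) (t j) = 1 := by
        refine Finset.prod_eq_one fun j _ => ?_
        unfold missIndicator
        by_cases hji : j = i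
        · simp [hji, hx]
        · by_cases hadj : G.Adj i j
          · rw [if_neg hji, if_pos hadj, if_neg fun h => ht j hadj h.1 h.2, sub_zero]
          · rw [if_neg hji, if_neg hadj]
      simp [h0, h1, hx]
  · have h1 : (1 : ℝ) ≤ ((x i : ℕ) : ℝ) := by
      have : 1 ≤ (x i : ℕ) := Nat.one_le_iff_ne_zero.2 fun h => hx (Fin.ext h)
      exact_mod_cast this
    rw [Finset.prod_eq_zero (Finset.mem_univ i) (by simp [missIndicator, hx]), sub_zero,
      min_eq_left]
    linarith [Finset.sum_nonneg hnn]

/-- Sums over joint outcomes of products over the individuals factor: this is independence. -/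
lemma sum_prod_outcomes (F : V → Fin 3 → Option V → ℝ) :
    ∑ x : V → Fin 3, ∑ t : V → Option V, ∏ j, F j (x j) (t j) = ∏ j, ∑ a, ∑ t, F j a t := by
  have h : ∀ j, ∑ a, ∑ t, F j a t = ∑ z : Fin 3 × Option V, F j z.1 z.2 := fun j =>
    (Fintype.sum_prod_type (fun z : Fin 3 × Option V => F j z.1 z.2)).symm
  simp_rw [h]
  rw [Finset.prod_univ_sum, Fintype.piFinset_univ, ← Fintype.sum_prod_type']
  exact (Fintype.sum_equiv (Equiv.arrowProdEquivProdArrow V (fun _ => Fin 3) (fun _ => Option V))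
    _ _ fun _ => rfl).symm

lemma sum_weight_missIndicator (q p : ℝ) (G : SimpleGraph V) (i j : V) :
    ∑ a, ∑ t, exogProb q p a * targetProb G j t * missIndicator G i j a t =
      if j = i then q else if G.Adj i j then 1 - p / (G.degree j : ℝ) else 1 := by
  have hs : ∀ a, ∑ t, exogProb q p a * targetProb G j t = exogProb q p a := fun a => by
    rw [← Finset.mul_sum, sum_targetProb, mul_one]
  by_cases hji : j = i
  · simp only [missIndicator, hji, if_true]
    rw [← hji]
    simp_rw [← Finset.sum_mul, hs]
    simp [exogProb]
  · by_cases hadj : G.Adj i j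
    · simp only [missIndicator, if_neg hji, if_pos hadj, mul_sub, mul_one, Finset.sum_sub_distrib,
        hs, sum_exogProb]
      congr 1
      rw [Finset.sum_eq_single 2 (fun a _ ha => by simp [ha]) (by simp),
        Finset.sum_eq_single (some i) (fun t _ ht => by simp [ht]) (by simp)]
      simp [exogProb, targetProb, hadj.symm, div_eq_mul_inv]
    · simp only [missIndicator, if_neg hji, if_neg hadj, mul_one, hs, sum_exogProb]

/-- Individual `i` gets no opportunity iff it has no exogenous one and no neighbour passes one on;
these events are independent. -/
lemma utility_eq (q p γ : ℝ) (G : SimpleGraph V) (i : V) :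
    utility q p γ G i = 1 - q * missProb p G i - γ * (G.degree i : ℝ) := by
  have h1 : ∑ x : V → Fin 3, ∑ t : V → Option V,
      ∏ j, exogProb q p (x j) * targetProb G j (t j) = 1 := by
    rw [sum_prod_outcomes (fun j a t => exogProb q p a * targetProb G j t)]
    refine Finset.prod_eq_one fun j _ => ?_
    simp_rw [← Finset.mul_sum, sum_targetProb, mul_one, sum_exogProb]
  have h2 : ∑ x : V → Fin 3, ∑ t : V → Option V,
      (∏ j, exogProb q p (x j) * targetProb G j (t j)) *
        ∏ j, missIndicator G i j (x j) (t j) = q * missProb p G i := by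
    simp_rw [← Finset.prod_mul_distrib]
    rw [sum_prod_outcomes
      (fun j a t => exogProb q p a * targetProb G j t * missIndicator G i j a t)]
    simp_rw [sum_weight_missIndicator]
    rw [← Finset.mul_prod_erase _ _ (Finset.mem_univ i), if_pos rfl, missProb]
    congr 1
    have hsub : G.neighborFinset i ⊆ Finset.univ.erase i := fun j hj => by
      rw [G.mem_neighborFinset] at hj
      simp [hj.ne']
    rw [← Finset.prod_subset hsub]
    · refine Finset.prod_congr rfl fun j hj => ?_
      rw [G.mem_neighborFinset] at hj
      rw [if_neg hj.ne', if_pos hj]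
    · intro j hj hj'
      rw [G.mem_neighborFinset] at hj'
      rw [if_neg (Finset.ne_of_mem_erase hj), if_neg hj']
  unfold utility realizedUtility
  simp_rw [min_one_opportunities, mul_sub, mul_one, Finset.sum_sub_distrib, ← Finset.sum_mul, h1,
    h2, one_mul]

/-! ### Effect of adding and deleting connections -/

lemma utility_addAndDrop (q p γ : ℝ) (G : SimpleGraph V) {i j : V} (hij : i ≠ j)
    (hadj : ¬ G.Adj i j) {S : Finset V} (hS : S ⊆ G.neighborFinset i) :
    utility q p γ (addAndDrop G i j (S : Set V)) i =
      1 - q * ((1 - p / ((G.degree j : ℝ) + 1)) *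
        ∏ l ∈ G.neighborFinset i \ S, (1 - p / (G.degree l : ℝ))) -
        γ * ((G.degree i : ℝ) + 1 - (S.card : ℝ)) := by
  have hjS : j ∉ S := fun h => hadj ((G.mem_neighborFinset i j).1 (hS h))
  have hiS : i ∉ S := fun h => G.irrefl ((G.mem_neighborFinset i i).1 (hS h))
  have hA : ∀ a b, (addAndDrop G i j (S : Set V)).Adj a b ↔
      (G.Adj a b ∨ (a = i ∧ b = j) ∨ (a = j ∧ b = i)) ∧
        ¬ ((a = i ∧ b ∈ S) ∨ (b = i ∧ a ∈ S)) := by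
    intro a b
    simp only [addAndDrop, SimpleGraph.deleteEdges_adj, SimpleGraph.sup_adj,
      SimpleGraph.edge_adj, Set.mem_ofPred_eq, Finset.mem_coe, Sym2.eq_iff]
    constructor
    · rintro ⟨h1, h2⟩
      refine ⟨by tauto, ?_⟩
      rintro (⟨rfl, h⟩ | ⟨rfl, h⟩)
      · exact h2 ⟨b, h, Or.inl ⟨rfl, rfl⟩⟩
      · exact h2 ⟨a, h, Or.inr ⟨rfl, rfl⟩⟩
    · rintro ⟨h1, h2⟩
      refine ⟨?_, ?_⟩
      · rcases h1 with h1 | ⟨rfl, rfl⟩ | ⟨rfl, rfl⟩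
        · exact Or.inl h1
        · exact Or.inr ⟨by tauto, hij⟩
        · exact Or.inr ⟨by tauto, hij.symm⟩
      · rintro ⟨l, hl, (⟨rfl, rfl⟩ | ⟨rfl, rfl⟩)⟩
        · exact h2 (Or.inl ⟨rfl, hl⟩)
        · exact h2 (Or.inr ⟨rfl, hl⟩)
  have hNi : (addAndDrop G i j (S : Set V)).neighborFinset i =
      insert j (G.neighborFinset i \ S) := by
    ext l
    simp only [SimpleGraph.mem_neighborFinset, hA, Finset.mem_insert, Finset.mem_sdiff]
    constructor
    · rintro ⟨h1 | h1 | h1, h2⟩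
      · exact Or.inr ⟨h1, fun h => h2 (Or.inl ⟨trivial, h⟩)⟩
      · exact Or.inl h1.2
      · exact absurd h1.1 hij
    · rintro (rfl | ⟨h1, h2⟩)
      · exact ⟨Or.inr (Or.inl ⟨trivial, rfl⟩), by rintro (h | h); exacts [hjS h.2, hij h.1.symm]⟩
      · exact ⟨Or.inl h1, by rintro (h | h); exacts [h2 h.2, hiS h.2]⟩
  have hNj : (addAndDrop G i j (S : Set V)).neighborFinset j = insert i (G.neighborFinset j) := by
    ext l
    simp only [SimpleGraph.mem_neighborFinset, hA, Finset.mem_insert]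
    constructor
    · rintro ⟨h1 | h1 | h1, h2⟩
      · exact Or.inr h1
      · exact absurd h1.1.symm hij
      · exact Or.inl h1.2
    · rintro (rfl | h1)
      · exact ⟨Or.inr (Or.inr ⟨trivial, rfl⟩), by rintro (h | h); exacts [hij h.1.symm, hjS h.2]⟩
      · exact ⟨Or.inl h1, by rintro (h | h); exacts [hij h.1.symm, hjS h.2]⟩
  have hNl : ∀ l ∈ G.neighborFinset i \ S,
      (addAndDrop G i j (S : Set V)).neighborFinset l = G.neighborFinset l := by
    intro l hl
    rw [Finset.mem_sdiff, G.mem_neighborFinset] at hl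
    have hli : l ≠ i := hl.1.ne'
    have hlj : l ≠ j := fun h => hadj (h ▸ hl.1)
    ext m
    simp only [SimpleGraph.mem_neighborFinset, hA]
    constructor
    · rintro ⟨h1 | h1 | h1, h2⟩
      · exact h1
      · exact absurd h1.1 hli
      · exact absurd h1.1 hlj
    · intro h
      exact ⟨Or.inl h, by rintro (h | h); exacts [hli h.1, hl.2 h.2]⟩
  have hj' : j ∉ G.neighborFinset i \ S := by simp [hadj]
  have hi' : i ∉ G.neighborFinset j := by simpa [SimpleGraph.adj_comm] using hadj
  have hdi : ((addAndDrop G i j (S : Set V)).degree i : ℝ) = (G.degree i : ℝ) + 1 - S.card := by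
    rw [← SimpleGraph.card_neighborFinset_eq_degree, hNi, Finset.card_insert_of_notMem hj',
      Finset.card_sdiff_of_subset hS, Nat.cast_add, Nat.cast_sub (Finset.card_le_card hS),
      SimpleGraph.card_neighborFinset_eq_degree]
    push_cast; ring
  have hdj : ((addAndDrop G i j (S : Set V)).degree j : ℝ) = (G.degree j : ℝ) + 1 := by
    rw [← SimpleGraph.card_neighborFinset_eq_degree, hNj, Finset.card_insert_of_notMem hi',
      SimpleGraph.card_neighborFinset_eq_degree]
    push_cast; ring
  rw [utility_eq, hdi, missProb, hNi, Finset.prod_insert hj', hdj]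
  congr 4
  refine Finset.prod_congr rfl fun l hl => ?_
  rw [← SimpleGraph.card_neighborFinset_eq_degree, hNl l hl,
    SimpleGraph.card_neighborFinset_eq_degree]

lemma utility_deleteEdges (q p γ : ℝ) (G : SimpleGraph V) {i j : V} (hadj : G.Adj i j) :
    utility q p γ (G.deleteEdges {s(i, j)}) i =
      1 - q * ∏ l ∈ (G.neighborFinset i).erase j, (1 - p / (G.degree l : ℝ)) -
        γ * ((G.degree i : ℝ) - 1) := by
  obtain ⟨G', hG'⟩ : ∃ G', G' = G.deleteEdges {s(i, j)} := ⟨_, rfl⟩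
  rw [← hG']
  have hA : ∀ a b, G'.Adj a b ↔
      G.Adj a b ∧ ¬ ((a = i ∧ b = j) ∨ (a = j ∧ b = i)) := by
    intro a b
    simp [hG', SimpleGraph.deleteEdges_adj]
  have hNi : G'.neighborFinset i = (G.neighborFinset i).erase j := by
    ext l
    simp only [SimpleGraph.mem_neighborFinset, hA, Finset.mem_erase]
    have := hadj.ne
    tauto
  have hNl : ∀ l ∈ (G.neighborFinset i).erase j,
      G'.neighborFinset l = G.neighborFinset l := by
    intro l hl
    rw [Finset.mem_erase, G.mem_neighborFinset] at hl
    have := hl.2.ne'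
    ext m
    simp only [SimpleGraph.mem_neighborFinset, hA]
    tauto
  have hj : j ∈ G.neighborFinset i := (G.mem_neighborFinset i j).2 hadj
  have hdi : (G'.degree i : ℝ) = (G.degree i : ℝ) - 1 := by
    rw [← SimpleGraph.card_neighborFinset_eq_degree, hNi, Finset.cast_card_erase_of_mem hj,
      SimpleGraph.card_neighborFinset_eq_degree]
  rw [utility_eq, hdi, missProb, hNi]
  congr 3
  refine Finset.prod_congr rfl fun l hl => ?_
  rw [← SimpleGraph.card_neighborFinset_eq_degree, hNl l hl,
    SimpleGraph.card_neighborFinset_eq_degree]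

end Utility

/-! ### Local description of equilibria -/

section Equilibrium

open scoped Classical

variable {V : Type*} [Fintype V] {q p γ : ℝ} {G : SimpleGraph V}

lemma degree_pos_of_adj {i j : V} (h : G.Adj i j) : 1 ≤ G.degree j :=
  (G.degree_pos_iff_exists_adj j).2 ⟨i, h.symm⟩

lemma one_sub_div_pos (hp1 : p < 1) {k : ℕ} (hk : 1 ≤ k) : 0 < 1 - p / (k : ℝ) := by
  have hk' : (1 : ℝ) ≤ k := by exact_mod_cast hk
  rw [sub_pos, div_lt_one (by linarith)]
  linarith

lemma one_sub_div_le_one (hp : 0 < p) (k : ℕ) : 1 - p / (k : ℝ) ≤ 1 := by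
  linarith [div_nonneg hp.le (Nat.cast_nonneg (α := ℝ) k)]

lemma one_sub_div_mono (hp : 0 < p) {k m : ℕ} (hk : 1 ≤ k) (h : k ≤ m) :
    1 - p / (k : ℝ) ≤ 1 - p / (m : ℝ) := by
  have hk' : (0 : ℝ) < k := by exact_mod_cast hk
  have := div_le_div_of_nonneg_left hp.le hk' (by exact_mod_cast h : (k : ℝ) ≤ m)
  linarith

lemma factor_pos (hp1 : p < 1) {i j : V} (h : j ∈ G.neighborFinset i) :
    0 < 1 - p / (G.degree j : ℝ) :=
  one_sub_div_pos hp1 (degree_pos_of_adj ((G.mem_neighborFinset i j).1 h))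

lemma prod_factor_pos (hp1 : p < 1) {i : V} {S : Finset V} (hS : S ⊆ G.neighborFinset i) :
    0 < ∏ l ∈ S, (1 - p / (G.degree l : ℝ)) :=
  Finset.prod_pos fun _ hl => factor_pos hp1 (hS hl)

lemma prod_factor_anti (hp : 0 < p) (hp1 : p < 1) {i : V} {S T : Finset V} (hST : S ⊆ T)
    (hT : T ⊆ G.neighborFinset i) :
    ∏ l ∈ T, (1 - p / (G.degree l : ℝ)) ≤ ∏ l ∈ S, (1 - p / (G.degree l : ℝ)) :=
  Finset.prod_le_prod_of_subset_of_le_one hST (fun _ hl => (factor_pos hp1 (hT hl)).le)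
    fun _ _ _ => one_sub_div_le_one hp _

lemma missProb_pos (hp1 : p < 1) (i : V) : 0 < missProb p G i :=
  prod_factor_pos hp1 subset_rfl

lemma missProb_le_one (hp : 0 < p) (hp1 : p < 1) (i : V) : missProb p G i ≤ 1 := by
  simpa [missProb] using
    prod_factor_anti hp hp1 (Finset.empty_subset _) (subset_refl (G.neighborFinset i))

/-- The probability that no neighbour of `i` other than `j` passes an opportunity to `i`. -/
noncomputable def missProbErase (p : ℝ) (G : SimpleGraph V) (i j : V) : ℝ :=
  ∏ l ∈ (G.neighborFinset i).erase j, (1 - p / (G.degree l : ℝ))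

lemma mul_missProbErase {i j : V} (h : G.Adj i j) :
    (1 - p / (G.degree j : ℝ)) * missProbErase p G i j = missProb p G i :=
  Finset.mul_prod_erase _ (fun l => 1 - p / (G.degree l : ℝ)) ((G.mem_neighborFinset i j).2 h)

lemma utility_deleteEdges_le_iff {i j : V} (h : G.Adj i j) :
    utility q p γ (G.deleteEdges {s(i, j)}) i ≤ utility q p γ G i ↔
      γ ≤ q * (p / (G.degree j : ℝ)) * missProbErase p G i j := by
  rw [utility_deleteEdges q p γ G h, utility_eq, ← mul_missProbErase h, ← missProbErase]
  constructor <;> intro h <;> linarith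

/-- No connection is worth severing: each is worth its cost to both of its ends. -/
lemma IsDFPNE.le_link_value (hG : IsDFPNE q p γ G) {i j : V} (h : G.Adj i j) :
    γ ≤ q * (p / (G.degree j : ℝ)) * missProbErase p G i j :=
  (utility_deleteEdges_le_iff h).1 (hG.2 i j h).1

/-- A sufficient reason for `i` to accept a new connection to `j`: some neighbour of `i` has more
contacts than `j` would have (so that `i` gains by a swap), or the new connection is worth more than
its cost. For an `i` none of whose connections is worth severing it is also necessary. -/
def Wants (q p γ : ℝ) (G : SimpleGraph V) (i j : V) : Prop :=
  (∃ l ∈ G.neighborFinset i, G.degree j + 1 < G.degree l) ∨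
    γ < q * (p / ((G.degree j : ℝ) + 1)) * missProb p G i

lemma Wants.exists_lt (hq : 0 < q) (hp : 0 < p) (hp1 : p < 1) {i j : V} (hij : i ≠ j)
    (hadj : ¬ G.Adj i j) (h : Wants q p γ G i j) :
    ∃ S ⊆ G.neighborSet i, utility q p γ G i < utility q p γ (addAndDrop G i j S) i := by
  rcases h with ⟨l, hl, hlt⟩ | h
  · have hS : ({l} : Finset V) ⊆ G.neighborFinset i := by simpa using hl
    have hl' := (G.mem_neighborFinset i l).1 hl
    refine ⟨(({l} : Finset V) : Set V), by simpa using hl', ?_⟩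
    rw [utility_addAndDrop q p γ G hij hadj hS, utility_eq, ← mul_missProbErase hl',
      Finset.sdiff_singleton_eq_erase, ← missProbErase]
    have h1 : 0 < missProbErase p G i l := prod_factor_pos hp1 (Finset.erase_subset _ _)
    have h2 : p / (G.degree l : ℝ) < p / ((G.degree j : ℝ) + 1) :=
      div_lt_div_of_pos_left hp (by positivity) (by exact_mod_cast hlt)
    have h3 : (1 - p / ((G.degree j : ℝ) + 1)) * missProbErase p G i l <
        (1 - p / (G.degree l : ℝ)) * missProbErase p G i l :=
      mul_lt_mul_of_pos_right (by linarith) h1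
    have h4 := mul_lt_mul_of_pos_left h3 hq
    simp only [Finset.card_singleton, Nat.cast_one]
    linarith
  · refine ⟨((∅ : Finset V) : Set V), by simp, ?_⟩
    rw [utility_addAndDrop q p γ G hij hadj (Finset.empty_subset _), utility_eq,
      Finset.sdiff_empty, ← missProb]
    simp only [Finset.card_empty, Nat.cast_zero]
    linarith

lemma IsDFPNE.adj_of_wants (hG : IsDFPNE q p γ G) (hq : 0 < q) (hp : 0 < p) (hp1 : p < 1)
    {i j : V} (hij : i ≠ j) (hi : Wants q p γ G i j) (hj : Wants q p γ G j i) : G.Adj i j := by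
  by_contra hadj
  obtain ⟨S, hS, h1⟩ := hi.exists_lt hq hp hp1 hij hadj
  obtain ⟨T, hT, h2⟩ := hj.exists_lt hq hp hp1 hij.symm fun h => hadj h.symm
  rcases hG.1 i j hij hadj S hS T hT with h | h
  · exact absurd h1 (not_lt.2 h)
  · exact absurd h2 (not_lt.2 h)

/-- The value of a set of connections is submodular, so if no single connection is worth severing
then neither is any set of connections. -/
lemma card_mul_le_of_le_link_value (hq : 0 < q) (hp : 0 < p) (hp1 : p < 1) {i : V}
    (hB : ∀ j, G.Adj i j → γ ≤ q * (p / (G.degree j : ℝ)) * missProbErase p G i j)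
    {S : Finset V} (hS : S ⊆ G.neighborFinset i) :
    γ * (S.card : ℝ) ≤
      q * (∏ l ∈ G.neighborFinset i \ S, (1 - p / (G.degree l : ℝ)) - missProb p G i) := by
  induction S using Finset.induction_on with
  | empty => simp [missProb]
  | insert a S ha ih =>
    have haN : a ∈ G.neighborFinset i := hS (Finset.mem_insert_self a S)
    have hadj := (G.mem_neighborFinset i a).1 haN
    have ih := ih ((Finset.subset_insert a S).trans hS)
    have haS : a ∈ G.neighborFinset i \ S := Finset.mem_sdiff.2 ⟨haN, ha⟩
    rw [Finset.card_insert_of_notMem ha]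
    rw [← Finset.mul_prod_erase _ _ haS] at ih
    have hE : G.neighborFinset i \ insert a S = (G.neighborFinset i \ S).erase a := by
      ext x; simp only [Finset.mem_sdiff, Finset.mem_insert, Finset.mem_erase]; tauto
    rw [hE]
    have h1 : missProbErase p G i a ≤
        ∏ l ∈ (G.neighborFinset i \ S).erase a, (1 - p / (G.degree l : ℝ)) :=
      prod_factor_anti hp hp1 (Finset.erase_subset_erase a Finset.sdiff_subset)
        (Finset.erase_subset _ _)
    have h2 := mul_le_mul_of_nonneg_left h1
      (show 0 ≤ q * (p / (G.degree a : ℝ)) by positivity)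
    have h3 := hB a hadj
    push_cast
    linarith

lemma utility_addAndDrop_le (hq : 0 < q) (hp : 0 < p) (hp1 : p < 1) {i j : V}
    (hB : ∀ j, G.Adj i j → γ ≤ q * (p / (G.degree j : ℝ)) * missProbErase p G i j)
    (hij : i ≠ j) (hadj : ¬ G.Adj i j) (hW : ¬ Wants q p γ G i j) {S : Set V}
    (hS : S ⊆ G.neighborSet i) :
    utility q p γ (addAndDrop G i j S) i ≤ utility q p γ G i := by
  obtain ⟨S, rfl⟩ : ∃ T : Finset V, S = (T : Set V) := ⟨S.toFinset, by simp⟩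
  have hS : S ⊆ G.neighborFinset i := fun x hx =>
    (G.mem_neighborFinset i x).2 (hS (Finset.mem_coe.2 hx))
  unfold Wants at hW
  push Not at hW
  rw [utility_addAndDrop q p γ G hij hadj hS, utility_eq]
  rcases S.eq_empty_or_nonempty with rfl | ⟨a, ha⟩
  · rw [Finset.sdiff_empty, ← missProb]
    simp only [Finset.card_empty, Nat.cast_zero]
    linarith [hW.2]
  · -- Dropping `a` and adding `j` is no better than keeping `a`: compare with dropping `S \ {a}`.
    have h1 := card_mul_le_of_le_link_value hq hp hp1 hB ((Finset.erase_subset a S).trans hS)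
    have hE : (G.neighborFinset i \ S.erase a) = insert a (G.neighborFinset i \ S) := by
      ext x
      simp only [Finset.mem_sdiff, Finset.mem_insert, Finset.mem_erase]
      constructor
      · tauto
      · rintro (rfl | h)
        · exact ⟨hS ha, by tauto⟩
        · tauto
    have h2 : p / ((G.degree j : ℝ) + 1) ≤ p / (G.degree a : ℝ) := by
      have := degree_pos_of_adj ((G.mem_neighborFinset i a).1 (hS ha))
      exact div_le_div_of_nonneg_left hp.le (by exact_mod_cast this)
        (by exact_mod_cast hW.1 a (hS ha))
    have h3 := prod_factor_pos (G := G) hp1 (Finset.sdiff_subset (s := G.neighborFinset i) (t := S))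
    rw [hE, Finset.prod_insert (by simp [ha]), Finset.cast_card_erase_of_mem ha] at h1
    have h4 := mul_le_mul_of_nonneg_left (mul_le_mul_of_nonneg_right h2 h3.le) hq.le
    linarith

lemma isDFPNE_of_local (hq : 0 < q) (hp : 0 < p) (hp1 : p < 1)
    (hB : ∀ i j, G.Adj i j → γ ≤ q * (p / (G.degree j : ℝ)) * missProbErase p G i j)
    (hW : ∀ i j, i ≠ j → ¬ G.Adj i j → ¬ Wants q p γ G i j ∨ ¬ Wants q p γ G j i) :
    IsDFPNE q p γ G := by
  refine ⟨fun i j hij hadj S hS T hT => ?_, fun i j hadj => ⟨?_, ?_⟩⟩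
  · rcases hW i j hij hadj with h | h
    · exact Or.inl (utility_addAndDrop_le hq hp hp1 (hB i) hij hadj h hS)
    · exact Or.inr (utility_addAndDrop_le hq hp hp1 (hB j) hij.symm (fun h => hadj h.symm) h hT)
  · exact (utility_deleteEdges_le_iff hadj).2 (hB i j hadj)
  · rw [Sym2.eq_swap]
    exact (utility_deleteEdges_le_iff hadj.symm).2 (hB j i hadj.symm)

/-- In an equilibrium nobody is worse off than without any connection. -/
lemma IsDFPNE.one_sub_le_utility (hG : IsDFPNE q p γ G) (hq : 0 < q) (hp : 0 < p) (hp1 : p < 1)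
    (i : V) : 1 - q ≤ utility q p γ G i := by
  have := card_mul_le_of_le_link_value hq hp hp1 (fun j h => hG.le_link_value (i := i) h)
    (subset_refl (G.neighborFinset i))
  rw [Finset.sdiff_self, Finset.prod_empty, G.card_neighborFinset_eq_degree] at this
  rw [utility_eq]
  linarith

lemma IsDFPNE.degree_mul_le (hG : IsDFPNE q p γ G) (hq : 0 < q) (hp : 0 < p) (hp1 : p < 1)
    (i : V) : γ * (G.degree i : ℝ) ≤ q * p := by
  by_cases h0 : G.degree i = 0
  · rw [h0, Nat.cast_zero, mul_zero]
    positivity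
  · obtain ⟨j, hj⟩ := (G.degree_pos_iff_exists_adj i).1 (Nat.pos_of_ne_zero h0)
    have h1 := hG.le_link_value hj.symm
    have h2 : missProbErase p G j i ≤ 1 := by
      simpa [missProbErase] using prod_factor_anti (G := G) hp hp1 (Finset.empty_subset _)
        (Finset.erase_subset i (G.neighborFinset j))
    have hd : (0 : ℝ) < G.degree i := by exact_mod_cast Nat.pos_of_ne_zero h0
    have h3 : γ ≤ q * (p / (G.degree i : ℝ)) :=
      h1.trans (mul_le_of_le_one_right (by positivity) h2)
    calc γ * (G.degree i : ℝ) ≤ q * (p / (G.degree i : ℝ)) * (G.degree i : ℝ) :=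
          mul_le_mul_of_nonneg_right h3 hd.le
      _ = q * p := by field_simp

/-! ### Social welfare -/

lemma one_sub_sum_le_missProb (hp : 0 < p) (hp1 : p < 1) (i : V) :
    1 - ∑ j ∈ G.neighborFinset i, p / (G.degree j : ℝ) ≤ missProb p G i := by
  unfold missProb
  have key : ∀ S ⊆ G.neighborFinset i, 1 - ∑ j ∈ S, p / (G.degree j : ℝ) ≤
      ∏ j ∈ S, (1 - p / (G.degree j : ℝ)) := by
    intro S
    induction S using Finset.induction_on with
    | empty => simp
    | insert a S ha ih =>
      intro hS
      have hS' := (Finset.subset_insert a S).trans hS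
      have h1 := ih hS'
      have h2 : ∏ j ∈ S, (1 - p / (G.degree j : ℝ)) ≤ 1 := by
        simpa using prod_factor_anti hp hp1 (Finset.empty_subset _) hS'
      have h3 : 0 ≤ p / (G.degree a : ℝ) := by positivity
      rw [Finset.sum_insert ha, Finset.prod_insert ha]
      nlinarith
  exact key _ subset_rfl

/-- Each individual with a neighbour adds at most `q * p - γ` to the social welfare: it passes on
one opportunity with probability `p`, which is of use with probability at most `q`, and it bears the
cost of at least one connection. -/
lemma welfare_le_sum (hq : 0 < q) (hp : 0 < p) (hp1 : p < 1) (hγ : 0 < γ) :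
    welfare q p γ G ≤ ∑ i, (1 - q + if G.degree i = 0 then 0 else q * p - γ) := by
  have h1 : welfare q p γ G ≤ ∑ i, (1 - q - γ * (G.degree i : ℝ)) +
      q * ∑ i, ∑ j ∈ G.neighborFinset i, p / (G.degree j : ℝ) := by
    rw [Finset.mul_sum, ← Finset.sum_add_distrib]
    refine Finset.sum_le_sum fun i _ => ?_
    rw [utility_eq]
    have := mul_le_mul_of_nonneg_left (one_sub_sum_le_missProb (G := G) hp hp1 i) hq.le
    linarith
  have h2 : ∑ i, ∑ j ∈ G.neighborFinset i, p / (G.degree j : ℝ) =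
      ∑ j, (G.degree j : ℝ) * (p / (G.degree j : ℝ)) := by
    rw [Finset.sum_comm' (t' := Finset.univ) (s' := fun j => G.neighborFinset j)
      (fun x y => by simp [SimpleGraph.adj_comm])]
    simp
  rw [h2, Finset.mul_sum, ← Finset.sum_add_distrib] at h1
  refine h1.trans (Finset.sum_le_sum fun i _ => ?_)
  split_ifs with h
  · simp [h]
  · have hd : (1 : ℝ) ≤ G.degree i := by exact_mod_cast Nat.pos_of_ne_zero h
    rw [mul_div_cancel₀ _ (by linarith)]
    nlinarith

lemma welfare_le (hq : 0 < q) (hp : 0 < p) (hp1 : p < 1) (hγ : 0 < γ) :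
    welfare q p γ G ≤ (Fintype.card V : ℝ) * (1 - q + max 0 (q * p - γ)) := by
  refine (welfare_le_sum hq hp hp1 hγ).trans ?_
  rw [← nsmul_eq_mul, ← Finset.card_univ]
  refine Finset.sum_le_card_nsmul _ _ _ fun i _ => ?_
  split_ifs
  · linarith [le_max_left 0 (q * p - γ)]
  · linarith [le_max_right 0 (q * p - γ)]

lemma IsDFPNE.card_mul_le_welfare (hG : IsDFPNE q p γ G) (hq : 0 < q) (hp : 0 < p) (hp1 : p < 1) :
    (Fintype.card V : ℝ) * (1 - q) ≤ welfare q p γ G := by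
  rw [← nsmul_eq_mul, ← Finset.card_univ]
  exact Finset.card_nsmul_le_sum _ _ _ fun i _ => hG.one_sub_le_utility hq hp hp1 i

lemma utility_of_isolated {i : V} (h : ∀ j, ¬ G.Adj i j) : utility q p γ G i = 1 - q := by
  have h0 : G.neighborFinset i = ∅ := by
    ext j; simp [h j]
  rw [utility_eq, missProb, ← G.card_neighborFinset_eq_degree, h0]
  simp

lemma welfare_bot : welfare q p γ (⊥ : SimpleGraph V) = (Fintype.card V : ℝ) * (1 - q) := by
  rw [← nsmul_eq_mul, ← Finset.card_univ]
  exact Finset.sum_eq_card_nsmul fun i _ => utility_of_isolated (by simp)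

lemma isDFPNE_bot (hq : 0 < q) (hp : 0 < p) (hp1 : p < 1) (hγ : q * p < γ) :
    IsDFPNE q p γ (⊥ : SimpleGraph V) := by
  refine isDFPNE_of_local hq hp hp1 (fun i j h => absurd h (by simp)) fun i j _ _ => Or.inl ?_
  generalize hG : (⊥ : SimpleGraph V) = G
  rintro (⟨l, hl, -⟩ | h)
  · rw [G.mem_neighborFinset, ← hG] at hl
    exact hl
  · have h1 : q * (p / ((G.degree j : ℝ) + 1)) ≤ q * p :=
      mul_le_mul_of_nonneg_left (div_le_self hp.le (by simp)) hq.le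
    have h2 := missProb_le_one (G := G) hp hp1 i
    have h4 : 0 ≤ q * (p / ((G.degree j : ℝ) + 1)) := by positivity
    linarith [mul_le_of_le_one_right h4 h2]

lemma IsDFPNE.eq_bot (hG : IsDFPNE q p γ G) (hq : 0 < q) (hp : 0 < p) (hp1 : p < 1)
    (hγ : q * p < γ) : G = ⊥ := by
  ext i j
  simp only [SimpleGraph.bot_adj, iff_false]
  intro h
  have h1 := hG.degree_mul_le hq hp hp1 j
  have h2 : (1 : ℝ) ≤ G.degree j := by exact_mod_cast degree_pos_of_adj h
  have : 0 < q * p := by positivity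
  nlinarith

lemma PoA_eq_one (hq : 0 < q) (hp : 0 < p) (hpq : p + q ≤ 1) (hγ : q * p < γ) {n : ℕ}
    (hn : 1 ≤ n) : PoA n q p γ = 1 := by
  have hp1 : p < 1 := by linarith
  have hγ0 : 0 < γ := lt_trans (by positivity) hγ
  have h1 : IsGreatest (Set.range fun G : SimpleGraph (Fin n) => welfare q p γ G)
      ((n : ℝ) * (1 - q)) := by
    refine ⟨⟨⊥, by simp [welfare_bot]⟩, ?_⟩
    rintro _ ⟨G, rfl⟩
    have := welfare_le (G := G) hq hp hp1 hγ0
    rwa [max_eq_left (by linarith), add_zero, Fintype.card_fin] at this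
  have h2 : {w : ℝ | ∃ G : SimpleGraph (Fin n), IsDFPNE q p γ G ∧ w = welfare q p γ G} =
      {(n : ℝ) * (1 - q)} := by
    ext w
    constructor
    · rintro ⟨G, hG, rfl⟩
      rw [hG.eq_bot hq hp hp1 hγ, welfare_bot]
      simp
    · rintro rfl
      exact ⟨⊥, isDFPNE_bot hq hp hp1 hγ, by simp [welfare_bot]⟩
  have hn' : (0 : ℝ) < n := by exact_mod_cast hn
  rw [PoA, h1.csSup_eq, h2, csInf_singleton, div_self]
  exact (mul_pos hn' (by linarith)).ne'

end Equilibrium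

/-! ### The value of a connection in a regular network -/

/-- In a `k`-regular network a connection is worth `q * p * linkValue p k` to each of its ends. -/
noncomputable def linkValue (p : ℝ) (k : ℕ) : ℝ := 1 / (k : ℝ) * (1 - p / k) ^ (k - 1)

/-- Bernoulli's inequality shows that passing from `(1 - p / k) ^ (k - 1)` to
`(1 - p / (k + 1)) ^ (k - 1)` gains at most the factor `(k + 1) / k`, which the change of the
factor `1 / k` makes up for. -/
lemma linkValue_succ_le {p : ℝ} (hp : 0 < p) (hp1 : p < 1) {k : ℕ} (hk : 1 ≤ k) :
    linkValue p (k + 1) ≤ linkValue p k := by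
  obtain ⟨m, rfl⟩ : ∃ m, k = m + 1 := ⟨k - 1, by omega⟩
  have ha : 0 < 1 - p / ((m + 1 + 1 : ℕ) : ℝ) := one_sub_div_pos hp1 (by omega)
  have ha1 : 1 - p / ((m + 1 + 1 : ℕ) : ℝ) ≤ 1 := one_sub_div_le_one hp _
  unfold linkValue
  simp only [Nat.add_sub_cancel]
  set a := 1 - p / ((m + 1 + 1 : ℕ) : ℝ) with hadef
  set b := 1 - p / ((m + 1 : ℕ) : ℝ) with hbdef
  have hm : (0 : ℝ) ≤ m := m.cast_nonneg
  have h1 : 1 - b / a ≤ 1 / (((m : ℝ) + 1) * (m + 1)) := by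
    have : 1 - b / a = p / (((m : ℝ) + 1) * (m + 2 - p)) := by
      have h2 : a = ((m : ℝ) + 2 - p) / (m + 2) := by
        rw [hadef]; push_cast; field_simp; ring
      have h3 : b = ((m : ℝ) + 1 - p) / (m + 1) := by
        rw [hbdef]; push_cast; field_simp
      have h4 : (m : ℝ) + 2 - p ≠ 0 := by linarith
      rw [h2, h3]
      field_simp
      ring
    rw [this, div_le_div_iff₀ (mul_pos (by linarith) (by linarith)) (by positivity)]
    nlinarith
  have h2 : ((m : ℝ) + 1) / (m + 2) ≤ (b / a) ^ m := by
    have h3 : 1 + (m : ℝ) * (b / a - 1) ≤ (1 + (b / a - 1)) ^ m := by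
      apply one_add_mul_le_pow
      have : 1 / (((m : ℝ) + 1) * (m + 1)) ≤ 1 := by
        rw [div_le_one (by positivity)]; nlinarith
      linarith
    rw [add_sub_cancel] at h3
    refine le_trans ?_ h3
    have h4 := mul_le_mul_of_nonneg_left h1 hm
    have h5 : (m : ℝ) * (1 / (((m : ℝ) + 1) * (m + 1))) ≤ 1 / (m + 2) := by
      rw [mul_one_div, div_le_div_iff₀ (by positivity) (by positivity)]
      nlinarith
    have h6 : ((m : ℝ) + 1) / (m + 2) = 1 - 1 / (m + 2) := by
      field_simp; ring
    rw [h6]; linarith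
  rw [div_pow, le_div_iff₀ (pow_pos ha m)] at h2
  calc 1 / ((m + 1 + 1 : ℕ) : ℝ) * a ^ (m + 1) ≤ 1 / ((m + 1 + 1 : ℕ) : ℝ) * a ^ m :=
        mul_le_mul_of_nonneg_left (pow_le_pow_of_le_one ha.le ha1 (Nat.le_succ m)) (by positivity)
    _ = 1 / ((m + 1 : ℕ) : ℝ) * (((m : ℝ) + 1) / (m + 2) * a ^ m) := by
        push_cast; field_simp; ring
    _ ≤ 1 / ((m + 1 : ℕ) : ℝ) * b ^ m := mul_le_mul_of_nonneg_left h2 (by positivity)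

lemma exists_isGreatest_linkValue {p g : ℝ} (hp : 0 < p) (hp1 : p < 1) (hg : 0 < g) (hg1 : g ≤ 1) :
    ∃ d : ℕ, IsGreatest {k : ℕ | 1 ≤ k ∧ g ≤ linkValue p k} d := by
  have hne : {k : ℕ | 1 ≤ k ∧ g ≤ linkValue p k}.Nonempty := ⟨1, by simp [linkValue, hg1]⟩
  have hbdd : BddAbove {k : ℕ | 1 ≤ k ∧ g ≤ linkValue p k} := by
    refine ⟨⌊1 / g⌋₊, fun k hk => Nat.le_floor ?_⟩
    have hk0 : (0 : ℝ) < k := by exact_mod_cast hk.1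
    have h1 : linkValue p k ≤ 1 / (k : ℝ) :=
      mul_le_of_le_one_right (by positivity)
        (pow_le_one₀ (one_sub_div_pos hp1 hk.1).le (one_sub_div_le_one hp k))
    rw [le_div_iff₀ hg, mul_comm, ← le_div_iff₀ hk0]
    exact hk.2.trans h1
  exact ⟨_, Nat.sSup_mem hne hbdd, fun k hk => le_csSup hbdd hk⟩

/-- The denominator of the expression for the price of anarchy: the utility of an individual with
`d + δ₁` contacts each of which has `d + δ₁ + δ₂` contacts. -/
noncomputable def baseUtility (q p γ : ℝ) (d : ℕ) (δ₁ δ₂ : ℝ) : ℝ :=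
  1 - q * (1 - p / (d + δ₁ + δ₂)) ^ ((d : ℝ) + δ₁) - γ * (d + δ₁)

lemma baseUtility_natCast (q p γ : ℝ) (d a b : ℕ) :
    baseUtility q p γ d a b =
      1 - q * (1 - p / ((d + a + b : ℕ) : ℝ)) ^ (d + a) - γ * ((d + a : ℕ) : ℝ) := by
  unfold baseUtility
  rw [← Nat.cast_add, Real.rpow_natCast]
  push_cast
  rfl

/-! ### Lower bound for the welfare of equilibria -/

section LowerBound

open scoped Classical

variable {V : Type*} [Fintype V] {q p γ : ℝ} {G : SimpleGraph V}

lemma prod_factor_le_pow (hp : 0 < p) (hp1 : p < 1) {i : V} {S : Finset V}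
    (hS : S ⊆ G.neighborFinset i) {k : ℕ} (hk : ∀ l ∈ S, G.degree l ≤ k) :
    ∏ l ∈ S, (1 - p / (G.degree l : ℝ)) ≤ (1 - p / (k : ℝ)) ^ S.card := by
  rw [← Finset.prod_const]
  refine Finset.prod_le_prod (fun l hl => (factor_pos hp1 (hS hl)).le) fun l hl => ?_
  exact one_sub_div_mono hp (degree_pos_of_adj ((G.mem_neighborFinset i l).1 (hS hl))) (hk l hl)

lemma pow_le_prod_factor (hp : 0 < p) (hp1 : p < 1) {S : Finset V} {k : ℕ} (hk1 : 1 ≤ k)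
    (hk : ∀ l ∈ S, k ≤ G.degree l) :
    (1 - p / (k : ℝ)) ^ S.card ≤ ∏ l ∈ S, (1 - p / (G.degree l : ℝ)) := by
  rw [← Finset.prod_const]
  exact Finset.prod_le_prod (fun l hl => (one_sub_div_pos hp1 hk1).le) fun l hl =>
    one_sub_div_mono hp hk1 (hk l hl)

lemma missProb_le_pow (hp : 0 < p) (hp1 : p < 1) {i : V} {k : ℕ}
    (hk : ∀ l ∈ G.neighborFinset i, G.degree l ≤ k) :
    missProb p G i ≤ (1 - p / (k : ℝ)) ^ G.degree i := by
  simpa [missProb] using prod_factor_le_pow hp hp1 (subset_refl (G.neighborFinset i)) hk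

lemma missProbErase_le_pow (hp : 0 < p) (hp1 : p < 1) {i j : V} (hj : G.Adj i j) {k : ℕ}
    (hk : ∀ l ∈ G.neighborFinset i, G.degree l ≤ k) :
    missProbErase p G i j ≤ (1 - p / (k : ℝ)) ^ (G.degree i - 1) := by
  have := prod_factor_le_pow hp hp1 (Finset.erase_subset j (G.neighborFinset i))
    fun l hl => hk l (Finset.mem_of_mem_erase hl)
  rwa [Finset.card_erase_of_mem ((G.mem_neighborFinset i j).2 hj),
    G.card_neighborFinset_eq_degree] at this

lemma card_le_of_pairwise_adj {J : Finset V} {D : ℕ} (hD : ∀ i, G.degree i ≤ D)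
    (h : ∀ i ∈ J, ∀ j ∈ J, i ≠ j → G.Adj i j) : J.card ≤ D + 1 := by
  rcases J.eq_empty_or_nonempty with rfl | ⟨i, hi⟩
  · simp
  · have hsub : J ⊆ insert i (G.neighborFinset i) := fun j hj => by
      by_cases hij : j = i
      · simp [hij]
      · simp [h i hi j hj (Ne.symm hij)]
    calc J.card ≤ _ := Finset.card_le_card hsub
      _ ≤ (G.neighborFinset i).card + 1 := Finset.card_insert_le _ _
      _ ≤ D + 1 := by rw [G.card_neighborFinset_eq_degree]; linarith [hD i]

/-- The individuals with at most `m - 2` contacts, some neighbour of whom has at least `m`. Each of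
them would swap that neighbour for any other of them, so in an equilibrium they form a clique. -/
noncomputable def swappers (G : SimpleGraph V) (m : ℕ) : Finset V :=
  {j | G.degree j + 2 ≤ m ∧ ∃ l ∈ G.neighborFinset j, m ≤ G.degree l}

lemma IsDFPNE.card_swappers_le (hG : IsDFPNE q p γ G) (hq : 0 < q) (hp : 0 < p) (hp1 : p < 1)
    {D : ℕ} (hD : ∀ i, G.degree i ≤ D) (m : ℕ) : (swappers G m).card ≤ D + 1 := by
  refine card_le_of_pairwise_adj hD fun i hi j hj hij => ?_
  simp only [swappers, Finset.mem_filter, Finset.mem_univ, true_and] at hi hj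
  obtain ⟨hi, l, hl, hml⟩ := hi
  obtain ⟨hj, l', hl', hml'⟩ := hj
  exact hG.adj_of_wants hq hp hp1 hij (Or.inl ⟨l, hl, by omega⟩) (Or.inl ⟨l', hl', by omega⟩)

/-- The individuals with fewer than `d` contacts who would profit from a further contact of
degree `d`. In an equilibrium they form a clique. -/
noncomputable def seekers (q p γ : ℝ) (G : SimpleGraph V) (d : ℕ) : Finset V :=
  {i | G.degree i + 1 ≤ d ∧ γ < q * (p / (d : ℝ)) * missProb p G i}

lemma IsDFPNE.card_seekers_le (hG : IsDFPNE q p γ G) (hq : 0 < q) (hp : 0 < p) (hp1 : p < 1)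
    {D : ℕ} (hD : ∀ i, G.degree i ≤ D) (d : ℕ) : (seekers q p γ G d).card ≤ D + 1 := by
  refine card_le_of_pairwise_adj hD fun i hi j hj hij => ?_
  simp only [seekers, Finset.mem_filter, Finset.mem_univ, true_and] at hi hj
  have key : ∀ a b : V, G.degree b + 1 ≤ d → γ < q * (p / (d : ℝ)) * missProb p G a →
      Wants q p γ G a b := fun a b hb h => Or.inr <| h.trans_le <| by
    have h1 : p / (d : ℝ) ≤ p / ((G.degree b : ℝ) + 1) :=
      div_le_div_of_nonneg_left hp.le (by positivity) (by exact_mod_cast hb)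
    exact mul_le_mul_of_nonneg_right (mul_le_mul_of_nonneg_left h1 hq.le) (missProb_pos hp1 a).le
  exact hG.adj_of_wants hq hp hp1 hij (key i j hj.1 hi.2) (key j i hi.1 hj.2)

/-- An individual with more than `d + 1` contacts, none of whom has more contacts than it, has a
contact with far fewer: otherwise one of the connections would not be worth its cost. -/
lemma IsDFPNE.exists_adj_degree_add_two_le (hG : IsDFPNE q p γ G) (hq : 0 < q) (hp : 0 < p)
    (hp1 : p < 1) {d : ℕ} (hd : ∀ k, d < k → q * p * linkValue p k < γ) {i : V}
    (hi : d + 2 ≤ G.degree i) (hmax : ∀ l ∈ G.neighborFinset i, G.degree l ≤ G.degree i) :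
    ∃ j, G.Adj i j ∧ G.degree j + 2 ≤ G.degree i := by
  by_contra! hcon
  obtain ⟨k, hk⟩ : ∃ k, G.degree i = k + 1 := ⟨G.degree i - 1, by omega⟩
  by_cases h : ∃ j, G.Adj i j ∧ G.degree j = G.degree i
  · obtain ⟨j, hij, hj⟩ := h
    have h1 := hG.le_link_value hij
    have h2 := missProbErase_le_pow hp hp1 hij hmax
    rw [hj] at h1
    have h3 := mul_le_mul_of_nonneg_left h2
      (show 0 ≤ q * (p / (G.degree i : ℝ)) by positivity)
    have h4 := hd (G.degree i) (by omega)
    rw [linkValue] at h4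
    have h5 : q * p * (1 / (G.degree i : ℝ) * (1 - p / (G.degree i : ℝ)) ^ (G.degree i - 1)) =
      q * (p / (G.degree i : ℝ)) * (1 - p / (G.degree i : ℝ)) ^ (G.degree i - 1) := by ring
    linarith
  · push Not at h
    have hall : ∀ l ∈ G.neighborFinset i, G.degree l = k := fun l hl => by
      have hl' := (G.mem_neighborFinset i l).1 hl
      have h1 := hmax l hl
      have h2 := hcon l hl'
      have h3 := h l hl'
      omega
    obtain ⟨j, hij⟩ := (G.degree_pos_iff_exists_adj i).1 (by omega)
    have h1 := hG.le_link_value hij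
    have h2 := missProbErase_le_pow hp hp1 hij fun l hl => (hall l hl).le
    rw [hall j ((G.mem_neighborFinset i j).2 hij)] at h1
    rw [hk, Nat.add_sub_cancel] at h2
    have hk1 : 1 ≤ k := by omega
    have h3 : (1 - p / (k : ℝ)) ^ k ≤ (1 - p / (k : ℝ)) ^ (k - 1) :=
      pow_le_pow_of_le_one (one_sub_div_pos hp1 hk1).le (one_sub_div_le_one hp k) (Nat.sub_le k 1)
    have h4 := mul_le_mul_of_nonneg_left (h2.trans h3)
      (show 0 ≤ q * (p / (k : ℝ)) by positivity)
    have h5 := hd k (by omega)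
    rw [linkValue] at h5
    have h6 : q * p * (1 / (k : ℝ) * (1 - p / (k : ℝ)) ^ (k - 1)) =
      q * (p / (k : ℝ)) * (1 - p / (k : ℝ)) ^ (k - 1) := by ring
    linarith

lemma card_biUnion_neighborFinset_le {D : ℕ} (hD : ∀ i, G.degree i ≤ D) (S : Finset V) :
    (S.biUnion fun i => G.neighborFinset i).card ≤ S.card * D :=
  Finset.card_biUnion_le_card_mul _ _ _ fun i _ =>
    (G.card_neighborFinset_eq_degree i).trans_le (hD i)

/-- The individuals with at least `k` contacts. -/
noncomputable def degreeGE (G : SimpleGraph V) (k : ℕ) : Finset V := {i | k ≤ G.degree i}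

/-- An individual of degree `k ≥ d + 2` without a neighbour of larger degree has a neighbour in
`swappers G k`, so the individuals of degree `k` are few if those of larger degree are. -/
lemma IsDFPNE.card_degreeGE_le (hG : IsDFPNE q p γ G) (hq : 0 < q) (hp : 0 < p) (hp1 : p < 1)
    {D : ℕ} (hD : ∀ i, G.degree i ≤ D) {d : ℕ} (hd : ∀ k, d < k → q * p * linkValue p k < γ)
    {k : ℕ} (hk : d + 2 ≤ k) :
    (degreeGE G k).card ≤ (degreeGE G (k + 1)).card * (D + 1) + (D + 1) * D := by
  have hsub : degreeGE G k ⊆ degreeGE G (k + 1) ∪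
      ((degreeGE G (k + 1)).biUnion (fun i => G.neighborFinset i) ∪
        (swappers G k).biUnion (fun i => G.neighborFinset i)) := by
    intro i hi
    simp only [degreeGE, swappers, Finset.mem_filter, Finset.mem_univ, true_and, Finset.mem_union,
      Finset.mem_biUnion, SimpleGraph.mem_neighborFinset] at hi ⊢
    by_contra! hcon
    obtain ⟨h1, h2, h3⟩ := hcon
    have hik : G.degree i = k := by omega
    obtain ⟨j, hij, hj⟩ := hG.exists_adj_degree_add_two_le hq hp hp1 hd (i := i) (by omega)
      fun l hl => by
        by_contra! hlt
        exact h2 l (by omega) ((G.mem_neighborFinset i l).1 hl).symm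
    exact h3 j ⟨by omega, i, hij.symm, by omega⟩ hij.symm
  refine (Finset.card_le_card hsub).trans ((Finset.card_union_le _ _).trans ?_)
  have h1 := Finset.card_union_le ((degreeGE G (k + 1)).biUnion (fun i => G.neighborFinset i))
    ((swappers G k).biUnion (fun i => G.neighborFinset i))
  have h2 := card_biUnion_neighborFinset_le hD (degreeGE G (k + 1))
  have h3 := card_biUnion_neighborFinset_le hD (swappers G k)
  have h4 := Nat.mul_le_mul_right D (hG.card_swappers_le hq hp hp1 hD k)
  linarith

end LowerBound

section Bounds

open scoped Classical

variable {q p γ : ℝ}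

/-- The number of individuals with more than `d + 1` contacts is bounded over all equilibria. -/
lemma exists_card_degreeGE_le (hq : 0 < q) (hp : 0 < p) (hp1 : p < 1) {d : ℕ}
    (hd : ∀ k, d < k → q * p * linkValue p k < γ) (D m : ℕ) :
    ∀ k, d + 2 ≤ k → D + 1 ≤ k + m → ∃ C : ℕ, ∀ (n : ℕ) (G : SimpleGraph (Fin n)),
      IsDFPNE q p γ G → (∀ i, G.degree i ≤ D) → (degreeGE G k).card ≤ C := by
  induction m with
  | zero =>
    intro k _ hkD
    refine ⟨0, fun n G _ hD => ?_⟩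
    rw [Nat.le_zero, Finset.card_eq_zero, degreeGE, Finset.filter_eq_empty_iff]
    intro i _ hi
    have := hD i
    omega
  | succ m ih =>
    intro k hk hkD
    obtain ⟨C, hC⟩ := ih (k + 1) (by omega) (by omega)
    refine ⟨C * (D + 1) + (D + 1) * D, fun n G hG hD => ?_⟩
    exact (hG.card_degreeGE_le hq hp hp1 hD hd hk).trans
      (Nat.add_le_add_right (Nat.mul_le_mul_right _ (hC n G hG hD)) _)

/-- Up to boundedly many exceptions, the utility of each individual in an equilibrium is at least
one of the values of `baseUtility`. -/
lemma exists_le_welfare_of_isDFPNE (hq : 0 < q) (hp : 0 < p) (hp1 : p < 1) (hq1 : q ≤ 1)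
    (hγ : 0 < γ) {d : ℕ} (hd1 : 1 ≤ d) (hd0 : γ ≤ q * p * linkValue p d)
    (hd : ∀ k, d < k → q * p * linkValue p k < γ) {b : ℝ}
    (h00 : b ≤ baseUtility q p γ d 0 0) (h01 : b ≤ baseUtility q p γ d 0 1)
    (h11 : b ≤ baseUtility q p γ d 1 1) :
    ∃ C : ℝ, ∀ (n : ℕ) (G : SimpleGraph (Fin n)), IsDFPNE q p γ G →
      (n : ℝ) * b - C ≤ welfare q p γ G := by
  set D := ⌊q * p / γ⌋₊ with hDdef
  obtain ⟨C, hC⟩ := exists_card_degreeGE_le hq hp hp1 hd D (D + 1) (d + 2) le_rfl (by omega)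
  refine ⟨|b| * ((C + 3 * (D + 1) : ℕ) : ℝ), fun n G hG => ?_⟩
  have hD : ∀ i, G.degree i ≤ D := fun i => by
    refine Nat.le_floor ?_
    rw [le_div_iff₀ hγ, mul_comm]
    exact hG.degree_mul_le hq hp hp1 i
  set B := degreeGE G (d + 2) ∪ (swappers G (d + 2) ∪ (swappers G (d + 3) ∪ seekers q p γ G d))
    with hB
  have hBcard : B.card ≤ C + 3 * (D + 1) := by
    have h1 := Finset.card_union_le (degreeGE G (d + 2))
      (swappers G (d + 2) ∪ (swappers G (d + 3) ∪ seekers q p γ G d))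
    have h2 := Finset.card_union_le (swappers G (d + 2)) (swappers G (d + 3) ∪ seekers q p γ G d)
    have h3 := Finset.card_union_le (swappers G (d + 3)) (seekers q p γ G d)
    have h4 := hC n G hG hD
    have h5 := hG.card_swappers_le hq hp hp1 hD (d + 2)
    have h6 := hG.card_swappers_le hq hp hp1 hD (d + 3)
    have h7 := hG.card_seekers_le hq hp hp1 hD d
    linarith
  have hgood : ∀ i ∉ B, b ≤ utility q p γ G i := by
    intro i hi
    simp only [hB, degreeGE, swappers, seekers, Finset.mem_union, Finset.mem_filter,
      Finset.mem_univ, true_and, not_or, not_and, not_exists, not_le, not_lt] at hi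
    obtain ⟨h1, h2, h3, h4⟩ := hi
    rw [utility_eq]
    rcases (by omega : G.degree i + 1 ≤ d ∨ G.degree i = d ∨ G.degree i = d + 1) with h | h | h
    · refine h00.trans ?_
      have h5 := h4 h
      have hd' : (0 : ℝ) < d := by exact_mod_cast hd1
      have hb := baseUtility_natCast q p γ d 0 0
      simp only [Nat.cast_zero, add_zero] at hb
      rw [hb]
      have h6 : (1 - p / (d : ℝ)) ^ d = (1 - p / (d : ℝ)) ^ (d - 1) * (1 - p / d) := by
        rw [← pow_succ, Nat.sub_add_cancel hd1]
      have h7 : q * missProb p G i ≤ d * γ / p := by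
        rw [le_div_iff₀ hp]
        calc q * missProb p G i * p = d * (q * (p / d) * missProb p G i) := by field_simp
          _ ≤ d * γ := mul_le_mul_of_nonneg_left h5 hd'.le
      have h8 : d * γ / p ≤ q * (1 - p / (d : ℝ)) ^ (d - 1) := by
        rw [div_le_iff₀ hp]
        calc d * γ ≤ d * (q * p * linkValue p d) := mul_le_mul_of_nonneg_left hd0 hd'.le
          _ = q * (1 - p / (d : ℝ)) ^ (d - 1) * p := by rw [linkValue]; field_simp
      have h9 := mul_le_mul_of_nonneg_right h8 (one_sub_div_pos hp1 hd1).le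
      have h10 : d * γ / p * (1 - p / d) = d * γ / p - γ := by field_simp
      have h11 : (G.degree i : ℝ) ≤ (d : ℝ) - 1 := by
        have : ((G.degree i + 1 : ℕ) : ℝ) ≤ d := by exact_mod_cast h
        push_cast at this; linarith
      have h12 := mul_le_mul_of_nonneg_left h11 hγ.le
      rw [h6]
      linarith
    · refine h01.trans ?_
      have hb := baseUtility_natCast q p γ d 0 1
      simp only [Nat.cast_zero, Nat.cast_one, add_zero] at hb
      rw [hb]
      have h5 := missProb_le_pow hp hp1 (k := d + 1) fun l hl => by
        have := h2 (by omega) l hl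
        omega
      rw [h] at h5 ⊢
      linarith [mul_le_mul_of_nonneg_left h5 hq.le]
    · refine h11.trans ?_
      have hb := baseUtility_natCast q p γ d 1 1
      simp only [Nat.cast_one] at hb
      rw [hb]
      have h5 := missProb_le_pow hp hp1 (k := d + 1 + 1) fun l hl => by
        have := h3 (by omega) l hl
        omega
      rw [h] at h5 ⊢
      linarith [mul_le_mul_of_nonneg_left h5 hq.le]
  have hall : ∀ i, b - (if i ∈ B then |b| else 0) ≤ utility q p γ G i := by
    intro i
    split_ifs with h
    · linarith [le_abs_self b, hG.one_sub_le_utility hq hp hp1 i]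
    · rw [sub_zero]; exact hgood i h
  have hsum := Finset.sum_le_sum fun i (_ : i ∈ Finset.univ) => hall i
  rw [Finset.sum_sub_distrib, Finset.sum_ite_mem, Finset.univ_inter, Finset.sum_const,
    Finset.sum_const, Finset.card_univ, Fintype.card_fin, nsmul_eq_mul, nsmul_eq_mul] at hsum
  have h13 : |b| * (B.card : ℝ) ≤ |b| * ((C + 3 * (D + 1) : ℕ) : ℝ) :=
    mul_le_mul_of_nonneg_left (by exact_mod_cast hBcard) (abs_nonneg b)
  rw [welfare]
  linarith

end Bounds

/-! ### Almost regular networks -/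

section Construction

open scoped Classical

/-- The bipartite graph on two copies of `ℤ/M` in which `a` and `b` are adjacent if `b - a` is one
of `0, …, d - 1`. -/
def bipartiteCirculant (M d : ℕ) : SimpleGraph (ZMod M ⊕ ZMod M) where
  Adj
    | .inl a, .inr b => (b - a).val < d
    | .inr b, .inl a => (b - a).val < d
    | _, _ => False
  symm := ⟨by rintro (a | a) (b | b) h <;> exact h⟩
  loopless := ⟨by rintro (a | a) h <;> exact h⟩

lemma bipartiteCirculant_inl_inr {M d : ℕ} (a b : ZMod M) :
    (bipartiteCirculant M d).Adj (.inl a) (.inr b) ↔ (b - a).val < d := Iff.rfl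

lemma bipartiteCirculant_inr_inl {M d : ℕ} (a b : ZMod M) :
    (bipartiteCirculant M d).Adj (.inr b) (.inl a) ↔ (b - a).val < d := Iff.rfl

lemma card_val_lt {M d : ℕ} [NeZero M] (hd : d ≤ M) :
    (Finset.univ.filter fun c : ZMod M => c.val < d).card = d := by
  suffices h : (Finset.univ.filter fun c : ZMod M => c.val < d).image ZMod.val = Finset.range d by
    rw [← Finset.card_image_of_injective _ (ZMod.val_injective M), h, Finset.card_range]
  ext k
  simp only [Finset.mem_image, Finset.mem_filter, Finset.mem_univ, true_and, Finset.mem_range]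
  constructor
  · rintro ⟨c, hc, rfl⟩
    exact hc
  · intro hk
    have : ((k : ZMod M)).val = k := ZMod.val_cast_of_lt (by omega)
    exact ⟨k, by omega, this⟩

lemma degree_bipartiteCirculant {M d : ℕ} [NeZero M] (hd : d ≤ M) (x : ZMod M ⊕ ZMod M) :
    (bipartiteCirculant M d).degree x = d := by
  rw [← SimpleGraph.card_neighborFinset_eq_degree]
  conv_rhs => rw [← card_val_lt hd]
  rcases x with a | b
  · refine (Finset.card_bij (fun c _ => Sum.inr (c + a)) ?_ ?_ ?_).symm
    · intro c hc
      simpa [SimpleGraph.mem_neighborFinset, bipartiteCirculant_inl_inr] using hc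
    · intro c _ c' _ h
      simpa using h
    · rintro (b | b) h
      · exact ((SimpleGraph.mem_neighborFinset _ _ _).1 h).elim
      · rw [SimpleGraph.mem_neighborFinset, bipartiteCirculant_inl_inr] at h
        exact ⟨b - a, by simpa using h, by simp⟩
  · refine (Finset.card_bij (fun c _ => Sum.inl (b - c)) ?_ ?_ ?_).symm
    · intro c hc
      simpa [SimpleGraph.mem_neighborFinset, bipartiteCirculant_inr_inl] using hc
    · intro c _ c' _ h
      simpa using h
    · rintro (a | a) h
      · rw [SimpleGraph.mem_neighborFinset, bipartiteCirculant_inr_inl] at h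
        exact ⟨b - a, by simpa using h, by simp⟩
      · exact ((SimpleGraph.mem_neighborFinset _ _ _).1 h).elim

lemma degree_sum_inl {U W : Type*} [Fintype U] [Fintype W] {G : SimpleGraph U} {H : SimpleGraph W}
    {S : SimpleGraph (U ⊕ W)} (hS : S = G ⊕g H) (u : U) : S.degree (Sum.inl u) = G.degree u := by
  have h : S.neighborFinset (Sum.inl u) =
      (G.neighborFinset u).map Function.Embedding.inl := by
    ext (x | x) <;> simp [hS]
  rw [← SimpleGraph.card_neighborFinset_eq_degree, h, Finset.card_map,
    SimpleGraph.card_neighborFinset_eq_degree]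

lemma degree_sum_inr {U W : Type*} [Fintype U] [Fintype W] {G : SimpleGraph U} {H : SimpleGraph W}
    {S : SimpleGraph (U ⊕ W)} (hS : S = G ⊕g H) (w : W) : S.degree (Sum.inr w) = H.degree w := by
  have h : S.neighborFinset (Sum.inr w) =
      (H.neighborFinset w).map Function.Embedding.inr := by
    ext (x | x) <;> simp [hS]
  rw [← SimpleGraph.card_neighborFinset_eq_degree, h, Finset.card_map,
    SimpleGraph.card_neighborFinset_eq_degree]

lemma degree_map_iso {U W : Type*} [Fintype U] [Fintype W] {G : SimpleGraph U} {H : SimpleGraph W}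
    (φ : G ≃g H) (x : U) : H.degree (φ x) = G.degree x := by
  have h : H.neighborFinset (φ x) = (G.neighborFinset x).map φ.toEquiv.toEmbedding := by
    ext y
    obtain ⟨z, rfl⟩ := φ.surjective y
    rw [SimpleGraph.mem_neighborFinset, φ.map_adj_iff, Finset.mem_map]
    constructor
    · intro h
      exact ⟨z, (SimpleGraph.mem_neighborFinset _ _ _).2 h, rfl⟩
    · rintro ⟨w, hw, h⟩
      have : w = z := φ.injective h
      exact this ▸ (SimpleGraph.mem_neighborFinset _ _ _).1 hw
  rw [← SimpleGraph.card_neighborFinset_eq_degree, h, Finset.card_map,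
    SimpleGraph.card_neighborFinset_eq_degree]

/-- A network on `Fin n` that is `d`-regular except for a copy of `H`, which is a union of
components. -/
lemma exists_regular_sum {W : Type*} [Fintype W] (H : SimpleGraph W) {d M n : ℕ} (hM : 1 ≤ M)
    (hd : d ≤ M) (hn : n = 2 * M + Fintype.card W) :
    ∃ (G : SimpleGraph (Fin n)) (f : W ↪ Fin n),
      (∀ a b, G.Adj (f a) (f b) ↔ H.Adj a b) ∧ (∀ a, G.degree (f a) = H.degree a) ∧
      (∀ i, i ∉ Finset.univ.map f → G.degree i = d) ∧
      (∀ i ∈ Finset.univ.map f, ∀ j, G.Adj i j → j ∈ Finset.univ.map f) := by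
  have : NeZero M := ⟨by omega⟩
  have hc : Fintype.card ((ZMod M ⊕ ZMod M) ⊕ W) = n := by
    simp only [Fintype.card_sum, ZMod.card]; omega
  obtain ⟨B, hB⟩ : ∃ B : SimpleGraph (ZMod M ⊕ ZMod M), ∀ x, B.degree x = d :=
    ⟨_, degree_bipartiteCirculant hd⟩
  obtain ⟨G, ⟨φ⟩⟩ : ∃ G : SimpleGraph (Fin n), Nonempty ((B ⊕g H) ≃g G) :=
    ⟨_, ⟨(B ⊕g H).overFinIso hc⟩⟩
  have hmem : ∀ y, φ y ∈ Finset.univ.map (Function.Embedding.inr.trans φ.toEquiv.toEmbedding) ↔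
      ∃ a : W, Sum.inr a = y := by
    intro y
    simp only [Finset.mem_map, Finset.mem_univ, true_and, Function.Embedding.trans_apply]
    constructor
    · rintro ⟨a, ha⟩
      exact ⟨a, φ.injective ha⟩
    · rintro ⟨a, rfl⟩
      exact ⟨a, rfl⟩
  refine ⟨G, Function.Embedding.inr.trans φ.toEquiv.toEmbedding, fun a b => ?_, fun a => ?_,
    fun i hi => ?_, fun i hi j hij => ?_⟩
  · exact φ.map_adj_iff.trans SimpleGraph.sum_adj_inr
  · exact (degree_map_iso φ (Sum.inr a)).trans (degree_sum_inr rfl a)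
  · obtain ⟨y, rfl⟩ := φ.surjective i
    rw [hmem] at hi
    rcases y with u | a
    · rw [degree_map_iso, degree_sum_inl rfl, hB]
    · exact absurd ⟨a, rfl⟩ hi
  · obtain ⟨y, rfl⟩ := φ.surjective i
    obtain ⟨z, rfl⟩ := φ.surjective j
    rw [hmem] at hi ⊢
    obtain ⟨a, rfl⟩ := hi
    have := φ.map_adj_iff.1 hij
    rcases z with u | b
    · simp at this
    · exact ⟨b, rfl⟩

lemma degree_add_one_of_eq_top {k : ℕ} {H : SimpleGraph (Fin k)} (hH : H = ⊤) (a : Fin k) :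
    H.degree a + 1 = k := by
  have h : H.neighborFinset a = Finset.univ.erase a := by
    ext b; simp [hH, eq_comm]
  rw [← SimpleGraph.card_neighborFinset_eq_degree, h, Finset.card_erase_of_mem (Finset.mem_univ a),
    Finset.card_univ, Fintype.card_fin]
  have := a.pos
  omega

/-- The complete graph on `2 * m + 1` vertices minus a matching of all vertices but `none`. -/
def cocktailCone (m : ℕ) : SimpleGraph (Option (Fin m × Bool)) :=
  (⊤ : SimpleGraph (Option (Fin m))).comap (Option.map Prod.fst)

lemma cocktailCone_adj {m : ℕ} (a b : Option (Fin m × Bool)) :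
    (cocktailCone m).Adj a b ↔ a.map Prod.fst ≠ b.map Prod.fst := Iff.rfl

lemma degree_cocktailCone_none (m : ℕ) : (cocktailCone m).degree none = 2 * m := by
  have h : (cocktailCone m).neighborFinset none = Finset.univ.map Function.Embedding.some := by
    ext (_ | b) <;> simp [cocktailCone_adj]
  rw [← SimpleGraph.card_neighborFinset_eq_degree, h, Finset.card_map, Finset.card_univ]
  simp [mul_comm]

lemma degree_cocktailCone_some {m : ℕ} (x : Fin m × Bool) :
    (cocktailCone m).degree (some x) + 1 = 2 * m := by
  have h : (cocktailCone m).neighborFinset (some x) =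
      Finset.univ \ {some (x.1, true), some (x.1, false)} := by
    ext (_ | ⟨y, b⟩)
    · simp [cocktailCone_adj]
    · rcases x with ⟨x, c⟩
      cases b <;> simp [cocktailCone_adj, eq_comm]
  rw [← SimpleGraph.card_neighborFinset_eq_degree, h,
    Finset.card_sdiff_of_subset (Finset.subset_univ _), Finset.card_pair (by simp),
    Finset.card_univ]
  have := x.1.pos
  simp
  omega

end Construction

section Equilibria

open scoped Classical

variable {V : Type*} [Fintype V] {q p γ : ℝ} {G : SimpleGraph V}

lemma le_link_value_of_le_linkValue (hq : 0 < q) (hp : 0 < p) (hp1 : p < 1) {i j : V} {k : ℕ}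
    (hij : G.Adj i j) (hi : G.degree i = k) (hj : G.degree j = k)
    (hN : ∀ l ∈ G.neighborFinset i, k ≤ G.degree l) (h : γ ≤ q * p * linkValue p k) :
    γ ≤ q * (p / (G.degree j : ℝ)) * missProbErase p G i j := by
  have hk : 1 ≤ k := hj ▸ degree_pos_of_adj hij
  have h1 := pow_le_prod_factor hp hp1 hk (S := (G.neighborFinset i).erase j)
    fun l hl => hN l (Finset.mem_of_mem_erase hl)
  rw [Finset.card_erase_of_mem ((G.mem_neighborFinset i j).2 hij),
    G.card_neighborFinset_eq_degree, hi, ← missProbErase] at h1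
  refine h.trans ?_
  rw [hj, linkValue]
  calc q * p * (1 / (k : ℝ) * (1 - p / k) ^ (k - 1))
      = q * (p / (k : ℝ)) * (1 - p / k) ^ (k - 1) := by ring
    _ ≤ _ := mul_le_mul_of_nonneg_left h1 (by positivity)

lemma not_wants (hq : 0 < q) (hp : 0 < p) (hp1 : p < 1) {i j : V} {k : ℕ}
    (hN : ∀ l ∈ G.neighborFinset i, G.degree l ≤ k) (hk : k ≤ G.degree j + 1)
    (h : q * (p / ((G.degree j : ℝ) + 1)) * (1 - p / (k : ℝ)) ^ G.degree i ≤ γ) :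
    ¬ Wants q p γ G i j := by
  rintro (⟨l, hl, hlt⟩ | hlt)
  · have := hN l hl
    omega
  · have := mul_le_mul_of_nonneg_left (missProb_le_pow hp hp1 hN)
      (show 0 ≤ q * (p / ((G.degree j : ℝ) + 1)) by positivity)
    linarith

lemma not_wants_of_linkValue_lt (hq : 0 < q) (hp : 0 < p) (hp1 : p < 1) {i j : V} {d : ℕ}
    (hi : d ≤ G.degree i) (hj : G.degree j = d)
    (hN : ∀ l ∈ G.neighborFinset i, G.degree l ≤ d + 1) (h : q * p * linkValue p (d + 1) < γ) :
    ¬ Wants q p γ G i j := by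
  refine not_wants hq hp hp1 hN (by omega) (le_trans ?_ h.le)
  rw [hj, linkValue, Nat.add_sub_cancel]
  calc q * (p / ((d : ℝ) + 1)) * (1 - p / ((d + 1 : ℕ) : ℝ)) ^ G.degree i
      ≤ q * (p / ((d : ℝ) + 1)) * (1 - p / ((d + 1 : ℕ) : ℝ)) ^ d :=
        mul_le_mul_of_nonneg_left (pow_le_pow_of_le_one (one_sub_div_pos hp1 (by omega)).le
          (one_sub_div_le_one hp _) hi) (by positivity)
    _ = _ := by push_cast; ring

lemma isDFPNE_of_regular_off_clique (hq : 0 < q) (hp : 0 < p) (hp1 : p < 1) {d : ℕ}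
    (hd0 : γ ≤ q * p * linkValue p d) (hd : ∀ k, d < k → q * p * linkValue p k < γ)
    {C : Finset V} (hC : ∀ i ∈ C, G.degree i + 1 = d) (hO : ∀ i, i ∉ C → G.degree i = d)
    (hclique : ∀ i ∈ C, ∀ j ∈ C, i ≠ j → G.Adj i j) (hsep : ∀ i ∈ C, ∀ j, G.Adj i j → j ∈ C)
    (hγ : C.Nonempty → q * (p / (d : ℝ)) * (1 - p / (d : ℝ)) ^ d ≤ γ ∨
      q * (p / ((d : ℝ) + 1)) * (1 - p / (d : ℝ)) ^ (d - 1) ≤ γ) :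
    IsDFPNE q p γ G := by
  have hsep' : ∀ i, i ∉ C → ∀ j, G.Adj i j → j ∉ C := fun i hi j hij hj =>
    hi (hsep j hj i hij.symm)
  -- an individual outside the clique does not want to be linked to one in the clique, or conversely
  have hmixed : ∀ i ∈ C, ∀ j, j ∉ C → ¬ Wants q p γ G i j ∨ ¬ Wants q p γ G j i := by
    intro i hi j hj
    rcases hγ ⟨i, hi⟩ with h | h
    · refine Or.inr (not_wants hq hp hp1 (k := d) (fun l hl => ?_) (hC i hi).ge ?_)
      · exact (hO l (hsep' j hj l ((G.mem_neighborFinset j l).1 hl))).le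
      · have : (G.degree i : ℝ) + 1 = d := by exact_mod_cast hC i hi
        rw [this, hO j hj]
        exact h
    · refine Or.inl (not_wants hq hp hp1 (k := d) (fun l hl => ?_) (by rw [hO j hj]; omega) ?_)
      · have := hC l (hsep i hi l ((G.mem_neighborFinset i l).1 hl))
        omega
      · rw [hO j hj, (by have := hC i hi; omega : G.degree i = d - 1)]
        exact h
  refine isDFPNE_of_local hq hp hp1 (fun i j hij => ?_) fun i j hij hadj => ?_
  · by_cases hi : i ∈ C
    · have hk := degree_pos_of_adj hij.symm
      have hdi := hC i hi
      refine le_link_value_of_le_linkValue hq hp hp1 hij rfl ?_ (fun l hl => ?_) ?_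
      · have := hC j (hsep i hi j hij)
        omega
      · have := hC l (hsep i hi l ((G.mem_neighborFinset i l).1 hl))
        omega
      · rw [← hdi] at hd0
        exact hd0.trans (mul_le_mul_of_nonneg_left (linkValue_succ_le hp hp1 hk) (by positivity))
    · exact le_link_value_of_le_linkValue hq hp hp1 hij (hO i hi) (hO j (hsep' i hi j hij))
        (fun l hl => (hO l (hsep' i hi l ((G.mem_neighborFinset i l).1 hl))).ge) hd0
  · by_cases hi : i ∈ C
    · by_cases hj : j ∈ C
      · exact absurd (hclique i hi j hj hij) hadj
      · exact hmixed i hi j hj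
    · by_cases hj : j ∈ C
      · exact (hmixed j hj i hi).symm
      · refine Or.inl (not_wants_of_linkValue_lt hq hp hp1 (hO i hi).ge (hO j hj) (fun l hl => ?_)
          (hd (d + 1) (by omega)))
        rw [hO l (hsep' i hi l ((G.mem_neighborFinset i l).1 hl))]
        omega

lemma isDFPNE_of_regular_off_singleton (hq : 0 < q) (hp : 0 < p) (hp1 : p < 1) {d : ℕ}
    (hd1 : 1 ≤ d) (hd0 : γ ≤ q * p * linkValue p d)
    (hd : ∀ k, d < k → q * p * linkValue p k < γ) {v : V} (hv : G.degree v = d + 1)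
    (hO : ∀ i, i ≠ v → G.degree i = d)
    (h1 : γ ≤ q * (p / (d : ℝ)) * (1 - p / (d : ℝ)) ^ d)
    (h2 : γ ≤ q * (p / ((d : ℝ) + 1)) * (1 - p / (d : ℝ)) ^ (d - 1)) :
    IsDFPNE q p γ G := by
  have hge : ∀ i, d ≤ G.degree i := fun i => by
    by_cases hi : i = v
    · rw [hi, hv]; omega
    · exact (hO i hi).ge
  have hle : ∀ i, G.degree i ≤ d + 1 := fun i => by
    by_cases hi : i = v
    · rw [hi, hv]
    · rw [hO i hi]; omega
  have hE : ∀ i j, G.Adj i j → (1 - p / (d : ℝ)) ^ (G.degree i - 1) ≤ missProbErase p G i j := by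
    intro i j hij
    have := pow_le_prod_factor hp hp1 hd1 (S := (G.neighborFinset i).erase j) fun l _ => hge l
    rwa [Finset.card_erase_of_mem ((G.mem_neighborFinset i j).2 hij),
      G.card_neighborFinset_eq_degree, ← missProbErase] at this
  refine isDFPNE_of_local hq hp hp1 (fun i j hij => ?_) fun i j hij hadj => ?_
  · by_cases hi : i = v
    · have hj : j ≠ v := hi ▸ hij.ne'
      have := hE i j hij
      rw [hi, hv, Nat.add_sub_cancel, ← hi] at this
      rw [hO j hj]
      exact h1.trans (mul_le_mul_of_nonneg_left this (by positivity))
    · by_cases hj : j = v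
      · have := hE i j hij
        rw [hO i hi] at this
        rw [hj, hv, ← hj]
        push_cast
        exact h2.trans (mul_le_mul_of_nonneg_left this (by positivity))
      · exact le_link_value_of_le_linkValue hq hp hp1 hij (hO i hi) (hO j hj) (fun l _ => hge l) hd0
  · by_cases hj : j = v
    · exact Or.inr (not_wants_of_linkValue_lt hq hp hp1 (hge j) (hO i (hj ▸ hij)) (fun l _ => hle l)
        (hd (d + 1) (by omega)))
    · exact Or.inl (not_wants_of_linkValue_lt hq hp hp1 (hge i) (hO j hj) (fun l _ => hle l)
        (hd (d + 1) (by omega)))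

lemma abs_welfare_sub_le (hq : 0 < q) (hp : 0 < p) (hp1 : p < 1) (hq1 : q ≤ 1) (hγ : 0 < γ)
    {d m : ℕ} {C : Finset V} (hm : C.card ≤ m) (hC : ∀ i ∈ C, G.degree i ≤ d + 1)
    (hO : ∀ i, i ∉ C → G.degree i = d) (hsep : ∀ i ∈ C, ∀ j, G.Adj i j → j ∈ C) :
    |welfare q p γ G - (Fintype.card V : ℝ) * baseUtility q p γ d 0 0| ≤
      (m : ℝ) * (1 + γ * (d + 1) + |baseUtility q p γ d 0 0|) := by
  set b := baseUtility q p γ d 0 0 with hb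
  have hgood : ∀ i, i ∉ C → utility q p γ G i = b := by
    intro i hi
    have hb' := baseUtility_natCast q p γ d 0 0
    simp only [Nat.cast_zero, add_zero] at hb'
    rw [utility_eq, hO i hi, hb, hb', missProb, Finset.prod_congr rfl (g := fun _ => 1 - p / (d : ℝ)),
      Finset.prod_const, G.card_neighborFinset_eq_degree, hO i hi]
    intro l hl
    rw [hO l fun hlC => hi (hsep l hlC i ((G.mem_neighborFinset i l).1 hl).symm)]
  have hbad : ∀ i ∈ C, |utility q p γ G i - b| ≤ 1 + γ * (d + 1) + |b| := by
    intro i hi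
    have h1 : |utility q p γ G i| ≤ 1 + γ * (d + 1) := by
      have h2 := mul_le_of_le_one_right hq.le (missProb_le_one (G := G) hp hp1 i)
      have h3 := mul_pos hq (missProb_pos (G := G) hp1 i)
      have h4 : (G.degree i : ℝ) ≤ d + 1 := by exact_mod_cast hC i hi
      have h5 := mul_le_mul_of_nonneg_left h4 hγ.le
      have h6 : 0 ≤ γ * (G.degree i : ℝ) := by positivity
      rw [utility_eq, abs_le]
      constructor <;> linarith
    exact (abs_sub _ _).trans (by linarith)
  have h1 : welfare q p γ G - (Fintype.card V : ℝ) * b = ∑ i ∈ C, (utility q p γ G i - b) := by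
    rw [← nsmul_eq_mul, ← Finset.card_univ, ← Finset.sum_const, welfare, ← Finset.sum_sub_distrib]
    refine (Finset.sum_subset (Finset.subset_univ C) fun i _ hi => ?_).symm
    rw [hgood i hi, sub_self]
  rw [h1]
  calc |∑ i ∈ C, (utility q p γ G i - b)| ≤ ∑ i ∈ C, |utility q p γ G i - b| :=
        Finset.abs_sum_le_sum_abs _ _
    _ ≤ (C.card : ℝ) * (1 + γ * (d + 1) + |b|) := by
        rw [← nsmul_eq_mul]; exact Finset.sum_le_card_nsmul _ _ _ hbad
    _ ≤ _ := mul_le_mul_of_nonneg_right (by exact_mod_cast hm) (by positivity)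

end Equilibria

section Existence

open scoped Classical

variable {q p γ : ℝ}

/-- For large `n` there is an equilibrium that is `d`-regular up to a bounded number of individuals.
If `n * d` is even it is `d`-regular. If not, `d` is odd, and one of two networks serves: either
`d` individuals form a component that is a clique, or one individual has `d + 1` contacts. The clique
is stable if nobody outside wants to be linked to it, or nobody in it wants to be linked to the rest;
when both fail, the inequalities are exactly those under which the `d + 1` connections of one
individual are worth their costs. -/
lemma exists_isDFPNE (hq : 0 < q) (hp : 0 < p) (hp1 : p < 1) (hq1 : q ≤ 1) (hγ : 0 < γ) {d : ℕ}
    (hd1 : 1 ≤ d) (hd0 : γ ≤ q * p * linkValue p d)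
    (hd : ∀ k, d < k → q * p * linkValue p k < γ) {n : ℕ} (hn : 3 * d + 4 ≤ n) :
    ∃ G : SimpleGraph (Fin n), IsDFPNE q p γ G ∧
      |welfare q p γ G - (n : ℝ) * baseUtility q p γ d 0 0| ≤
        ((d + 2 : ℕ) : ℝ) * (1 + γ * (d + 1) + |baseUtility q p γ d 0 0|) := by
  rcases Nat.even_or_odd n with ⟨M, hM⟩ | hno
  · obtain ⟨G, f, -, -, hO, -⟩ := exists_regular_sum (⊤ : SimpleGraph (Fin 0)) (d := d) (M := M)
      (n := n) (by omega) (by omega) (by simp; omega)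
    have hO' : ∀ i, i ∉ (∅ : Finset (Fin n)) → G.degree i = d := fun i _ => hO i (by simp)
    refine ⟨G, isDFPNE_of_regular_off_clique hq hp hp1 hd0 hd (C := ∅) (by simp) hO' (by simp)
      (by simp) (by simp), ?_⟩
    simpa using abs_welfare_sub_le hq hp hp1 hq1 hγ (G := G) (C := ∅) (m := d + 2) (by simp)
      (by simp) hO' (by simp)
  rcases Nat.even_or_odd d with hde | hdo
  · obtain ⟨M, hM⟩ : ∃ M, n = 2 * M + (d + 1) := ⟨(n - (d + 1)) / 2, by grind⟩
    obtain ⟨G, f, -, hdeg, hO, -⟩ := exists_regular_sum (⊤ : SimpleGraph (Fin (d + 1))) (d := d)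
      (M := M) (n := n) (by omega) (by omega) (by simp; omega)
    have hO' : ∀ i, i ∉ (∅ : Finset (Fin n)) → G.degree i = d := fun i _ => by
      by_cases hi : i ∈ Finset.univ.map f
      · obtain ⟨a, -, rfl⟩ := Finset.mem_map.1 hi
        have := degree_add_one_of_eq_top rfl a
        rw [hdeg]
        omega
      · exact hO i hi
    refine ⟨G, isDFPNE_of_regular_off_clique hq hp hp1 hd0 hd (C := ∅) (by simp) hO' (by simp)
      (by simp) (by simp), ?_⟩
    simpa using abs_welfare_sub_le hq hp hp1 hq1 hγ (G := G) (C := ∅) (m := d + 2) (by simp)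
      (by simp) hO' (by simp)
  -- In the remaining case `n * d` is odd and there is no `d`-regular network.
  by_cases hcase : q * (p / (d : ℝ)) * (1 - p / (d : ℝ)) ^ d ≤ γ ∨
      q * (p / ((d : ℝ) + 1)) * (1 - p / (d : ℝ)) ^ (d - 1) ≤ γ
  · obtain ⟨M, hM⟩ : ∃ M, n = 2 * M + d := ⟨(n - d) / 2, by grind⟩
    obtain ⟨G, f, hadj, hdeg, hO, hsep⟩ := exists_regular_sum (⊤ : SimpleGraph (Fin d)) (d := d)
      (M := M) (n := n) (by omega) (by omega) (by simp; omega)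
    have hC : ∀ i ∈ Finset.univ.map f, G.degree i + 1 = d := by
      intro i hi
      obtain ⟨a, -, rfl⟩ := Finset.mem_map.1 hi
      rw [hdeg]
      exact degree_add_one_of_eq_top rfl a
    refine ⟨G, isDFPNE_of_regular_off_clique hq hp hp1 hd0 hd hC hO ?_ hsep fun _ => hcase, ?_⟩
    · intro i hi j hj hij
      obtain ⟨a, -, rfl⟩ := Finset.mem_map.1 hi
      obtain ⟨b, -, rfl⟩ := Finset.mem_map.1 hj
      rw [hadj, SimpleGraph.top_adj]
      exact fun h => hij (h ▸ rfl)
    · simpa using abs_welfare_sub_le hq hp hp1 hq1 hγ (G := G) (C := Finset.univ.map f) (m := d + 2)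
        (by simp) (fun i hi => by have := hC i hi; omega) hO hsep
  · push Not at hcase
    obtain ⟨m, hm⟩ : ∃ m, d + 1 = 2 * m := ⟨(d + 1) / 2, by grind⟩
    obtain ⟨M, hM⟩ : ∃ M, n = 2 * M + (d + 2) := ⟨(n - (d + 2)) / 2, by grind⟩
    have hcard : Fintype.card (Option (Fin m × Bool)) = d + 2 := by simp; omega
    obtain ⟨G, f, hadj, hdeg, hO, hsep⟩ := exists_regular_sum (cocktailCone m) (d := d)
      (M := M) (n := n) (by omega) (by omega) (by rw [hcard]; omega)
    have hv : G.degree (f none) = d + 1 := by rw [hdeg, degree_cocktailCone_none, hm]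
    have hO' : ∀ i, i ≠ f none → G.degree i = d := by
      intro i hi
      by_cases hif : i ∈ Finset.univ.map f
      · obtain ⟨a, -, rfl⟩ := Finset.mem_map.1 hif
        rcases a with _ | x
        · exact absurd rfl hi
        · have := degree_cocktailCone_some x
          rw [hdeg]
          omega
      · exact hO i hif
    refine ⟨G, isDFPNE_of_regular_off_singleton hq hp hp1 hd1 hd0 hd hv hO' hcase.1.le hcase.2.le,
      ?_⟩
    have hle : ∀ i ∈ Finset.univ.map f, G.degree i ≤ d + 1 := fun i _ => by
      by_cases hi : i = f none
      · rw [hi, hv]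
      · rw [hO' i hi]; omega
    simpa using abs_welfare_sub_le hq hp hp1 hq1 hγ (G := G) (C := Finset.univ.map f) (m := d + 2)
      (by rw [Finset.card_map, Finset.card_univ, hcard]) hle hO hsep

/-- A perfect matching, up to one individual, is optimal up to a bounded amount. -/
lemma exists_welfare_near_optimal (hq : 0 < q) (hp : 0 < p) (hp1 : p < 1) (hq1 : q ≤ 1)
    (hγ : 0 < γ) : ∃ K : ℝ, ∀ n : ℕ, 2 ≤ n → ∃ G : SimpleGraph (Fin n),
      (n : ℝ) * (1 - q * (1 - p) - γ) - K ≤ welfare q p γ G := by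
  refine ⟨((1 : ℕ) : ℝ) * (1 + γ * ((1 : ℕ) + 1) + |baseUtility q p γ 1 0 0|), fun n hn => ?_⟩
  obtain ⟨G, f, -, hdeg, hO, hsep⟩ := exists_regular_sum (⊤ : SimpleGraph (Fin (n % 2))) (d := 1)
    (M := n / 2) (n := n) (by omega) (by omega) (by simp; omega)
  have hC : ∀ i ∈ Finset.univ.map f, G.degree i ≤ 1 + 1 := by
    intro i hi
    obtain ⟨a, -, rfl⟩ := Finset.mem_map.1 hi
    have := degree_add_one_of_eq_top rfl a
    rw [hdeg]
    omega
  have h := abs_welfare_sub_le hq hp hp1 hq1 hγ (G := G) (C := Finset.univ.map f) (m := 1)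
    (by simp; omega) hC hO hsep
  have hb : baseUtility q p γ 1 0 0 = 1 - q * (1 - p) - γ := by
    simp [baseUtility]
  refine ⟨G, ?_⟩
  have h' := (abs_le.1 h).1
  rw [Fintype.card_fin] at h'
  rw [← hb]
  linarith

end Existence

/-! ### The price of anarchy -/

section PriceOfAnarchy

variable {q p γ : ℝ}

lemma extQuot_antitone {a b c : ℝ} (ha : 0 < a) (h : b ≤ c) : extQuot a c ≤ extQuot a b := by
  unfold extQuot
  by_cases hb : 0 < b
  · rw [if_pos hb, if_pos (hb.trans_le h), EReal.coe_le_coe_iff]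
    exact div_le_div_of_nonneg_left ha.le hb h
  · rw [if_neg hb]
    exact le_top

lemma continuousOn_baseUtility {d : ℕ} (hd : 1 ≤ d) :
    ContinuousOn (fun x : ℝ × ℝ => baseUtility q p γ d x.1 x.2)
      (Set.Icc (0 : ℝ) 1 ×ˢ Set.Icc (0 : ℝ) 1) := by
  have hd' : (1 : ℝ) ≤ d := by exact_mod_cast hd
  unfold baseUtility
  refine ContinuousOn.sub (continuousOn_const.sub (continuousOn_const.mul ?_)) (by fun_prop)
  refine ContinuousOn.rpow (continuousOn_const.sub ?_) (by fun_prop) ?_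
  · refine continuousOn_const.div (by fun_prop) ?_
    rintro ⟨x, y⟩ ⟨hx, hy⟩
    have := hx.1
    have := hy.1
    simp only at *
    linarith
  · rintro ⟨x, y⟩ ⟨hx, hy⟩
    have := hx.1
    simp only at *
    right; linarith

lemma tendsto_linear_div_linear (a k b c : ℝ) (hb : b ≠ 0) :
    Tendsto (fun n : ℕ => ((n : ℝ) * a + k) / ((n : ℝ) * b + c)) atTop (𝓝 (a / b)) := by
  have h : ∀ u v : ℝ, Tendsto (fun n : ℕ => u + v / (n : ℝ)) atTop (𝓝 u) := fun u v => by
    simpa using (tendsto_const_nhds (x := u)).add (tendsto_const_div_atTop_nhds_zero_nat v)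
  refine ((h a k).div (h b c) hb).congr' ?_
  filter_upwards [eventually_ge_atTop 1] with n hn
  have hn' : (n : ℝ) ≠ 0 := by
    have : n ≠ 0 := by omega
    exact_mod_cast this
  have h1 : (n : ℝ) * a + k = n * (a + k / n) := by field_simp
  have h2 : (n : ℝ) * b + c = n * (b + c / n) := by field_simp
  rw [h1, h2, Pi.div_apply, mul_div_mul_left _ _ hn']

lemma tendsto_max_zero {u v : ℕ → ℝ} {l : ℝ} (h : ∀ᶠ n in atTop, u n ≤ v n)
    (hv : Tendsto v atTop (𝓝 l)) (hl : l ≤ 0) : Tendsto (fun n => max (u n) 0) atTop (𝓝 0) := by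
  have h1 : Tendsto (fun n => max (v n) 0) atTop (𝓝 0) := by
    have := hv.max (tendsto_const_nhds (x := (0 : ℝ)))
    rwa [max_eq_right hl] at this
  refine squeeze_zero' (Eventually.of_forall fun n => le_max_right _ _) ?_ h1
  filter_upwards [h] with n hn
  exact max_le_max_right 0 hn

/-- A sequence squeezed between two sequences with limits in `[m, M]` differs by a null sequence from
a sequence in `[m, M]`. -/
lemma exists_tendsto_zero_mem_Icc {x : ℕ → ℝ} {m M : ℝ} {L U : ℕ → ℝ} {l u : ℝ} (hmM : m ≤ M)
    (hL : ∀ᶠ n in atTop, L n ≤ x n) (hU : ∀ᶠ n in atTop, x n ≤ U n) (hl : Tendsto L atTop (𝓝 l))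
    (hu : Tendsto U atTop (𝓝 u)) (hml : m ≤ l) (huM : u ≤ M) :
    ∃ e : ℕ → ℝ, Tendsto e atTop (𝓝 0) ∧ ∀ n, m ≤ x n + e n ∧ x n + e n ≤ M := by
  have h1 := tendsto_max_zero (u := fun n => m - x n) (v := fun n => m - L n)
    (hL.mono fun n hn => by linarith) (hl.const_sub m) (by linarith)
  have h2 := tendsto_max_zero (u := fun n => x n - M) (v := fun n => U n - M)
    (hU.mono fun n hn => by linarith) (hu.sub_const M) (by linarith)
  refine ⟨fun n => max (m - x n) 0 - max (x n - M) 0, by simpa using h1.sub h2, fun n => ?_⟩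
  rcases le_total (m - x n) 0 with h3 | h3 <;> rcases le_total (x n - M) 0 with h4 | h4 <;>
    simp only [max_eq_left, max_eq_right, h3, h4] <;> constructor <;> linarith

lemma finite_range_welfare (n : ℕ) :
    (Set.range fun G : SimpleGraph (Fin n) => welfare q p γ G).Finite := Set.finite_range _

lemma isDFPNE_welfare_subset (n : ℕ) :
    {w : ℝ | ∃ G : SimpleGraph (Fin n), IsDFPNE q p γ G ∧ w = welfare q p γ G} ⊆
      Set.range fun G : SimpleGraph (Fin n) => welfare q p γ G := by
  rintro w ⟨G, -, rfl⟩
  exact ⟨G, rfl⟩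

/-- The lower bound compares a near-perfect matching with an almost `d`-regular equilibrium; the upper
bound compares the largest conceivable welfare with any lower bound `B` for the welfare of
equilibria. -/
lemma PoA_bounds (hq : 0 < q) (hp : 0 < p) (hp1 : p < 1) (hq1 : q < 1) (hγ : 0 < γ)
    (hγ' : γ ≤ q * p) {d : ℕ} (hd1 : 1 ≤ d) (hd0 : γ ≤ q * p * linkValue p d)
    (hd : ∀ k, d < k → q * p * linkValue p k < γ) :
    ∃ K : ℝ, ∀ᶠ n : ℕ in atTop,
      ((n : ℝ) * (1 - q * (1 - p) - γ) + -K) / ((n : ℝ) * baseUtility q p γ d 0 0 + K) ≤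
        PoA n q p γ ∧
      ∀ B : ℝ, 0 < B →
        (∀ G : SimpleGraph (Fin n), IsDFPNE q p γ G → B ≤ welfare q p γ G) →
        PoA n q p γ ≤ ((n : ℝ) * (1 - q * (1 - p) - γ)) / B := by
  obtain ⟨K₁, hK₁⟩ := exists_welfare_near_optimal hq hp hp1 hq1.le hγ
  set K₂ := ((d + 2 : ℕ) : ℝ) * (1 + γ * (d + 1) + |baseUtility q p γ d 0 0|)
  refine ⟨max K₁ K₂, ?_⟩
  have hA : 0 < 1 - q * (1 - p) - γ := by linarith
  have hlarge : ∀ᶠ n : ℕ in atTop, max K₁ K₂ / (1 - q * (1 - p) - γ) ≤ (n : ℝ) :=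
    tendsto_natCast_atTop_atTop.eventually_ge_atTop _
  filter_upwards [eventually_ge_atTop (3 * d + 4), hlarge] with n hn hnK
  obtain ⟨G₀, hG₀, hw₀⟩ := exists_isDFPNE hq hp hp1 hq1.le hγ hd1 hd0 hd hn
  obtain ⟨G₁, hG₁⟩ := hK₁ n (by omega)
  set S := {w : ℝ | ∃ G : SimpleGraph (Fin n), IsDFPNE q p γ G ∧ w = welfare q p γ G} with hS
  have hSbdd : BddBelow S := ((finite_range_welfare n).subset (isDFPNE_welfare_subset n)).bddBelow
  have hSne : S.Nonempty := ⟨_, G₀, hG₀, rfl⟩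
  have hn0 : (0 : ℝ) < n := by
    have : 0 < n := by omega
    exact_mod_cast this
  have hSpos : 0 < sInf S := by
    have h1 : (n : ℝ) * (1 - q) ≤ sInf S := by
      refine le_csInf hSne ?_
      rintro w ⟨G, hG, rfl⟩
      simpa using hG.card_mul_le_welfare hq hp hp1
    exact (mul_pos hn0 (by linarith)).trans_le h1
  have hSle : sInf S ≤ (n : ℝ) * baseUtility q p γ d 0 0 + max K₁ K₂ := by
    refine (csInf_le hSbdd ⟨G₀, hG₀, rfl⟩).trans ?_
    have := (abs_le.1 hw₀).2
    linarith [le_max_right K₁ K₂]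
  have hTle : sSup (Set.range fun G : SimpleGraph (Fin n) => welfare q p γ G) ≤
      (n : ℝ) * (1 - q * (1 - p) - γ) := by
    refine csSup_le ⟨_, G₁, rfl⟩ ?_
    rintro _ ⟨G, rfl⟩
    have := welfare_le (G := G) hq hp hp1 hγ
    rw [max_eq_right (by linarith), Fintype.card_fin] at this
    exact this.trans_eq (by ring)
  have hTge : (n : ℝ) * (1 - q * (1 - p) - γ) + -max K₁ K₂ ≤
      sSup (Set.range fun G : SimpleGraph (Fin n) => welfare q p γ G) := by
    refine le_trans ?_ (le_csSup (finite_range_welfare n).bddAbove ⟨G₁, rfl⟩)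
    linarith [le_max_left K₁ K₂]
  constructor
  · refine div_le_div₀ ?_ hTge hSpos hSle
    refine le_trans ?_ hTge
    rw [div_le_iff₀ hA] at hnK
    linarith
  · intro B hB hBle
    refine div_le_div₀ (mul_nonneg hn0.le hA.le) hTle hB (le_csInf hSne ?_)
    rintro w ⟨G, hG, rfl⟩
    exact hBle G hG

/-- With `b = baseUtility q p γ d 0 0`, the utility in a `d`-regular network, the price of anarchy is
at least `(1 - q * (1 - p) - γ) / b` in the limit. From above it is bounded in the limit by the same
quotient with the minimum of `baseUtility` over the unit square in place of `b`, provided that this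
minimum is positive; otherwise the upper bound asked for is `⊤`. -/
lemma exists_eqDelta_PoA (hq : 0 < q) (hp : 0 < p) (hp1 : p < 1) (hq1 : q < 1) (hγ : 0 < γ)
    (hγ' : γ ≤ q * p) {d : ℕ} (hd1 : 1 ≤ d) (hd0 : γ ≤ q * p * linkValue p d)
    (hd : ∀ k, d < k → q * p * linkValue p k < γ) :
    ∃ e : ℕ → ℝ, Tendsto e atTop (𝓝 0) ∧ ∀ᶠ n : ℕ in atTop,
      EqDelta ((PoA n q p γ + e n : ℝ) : EReal) (poaExpr q p γ d) := by
  set A := 1 - q * (1 - p) - γ with hAdef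
  have hA : 0 < A := by rw [hAdef]; linarith
  have hcompact : IsCompact (Set.Icc (0 : ℝ) 1 ×ˢ Set.Icc (0 : ℝ) 1) :=
    isCompact_Icc.prod isCompact_Icc
  have hne : (Set.Icc (0 : ℝ) 1 ×ˢ Set.Icc (0 : ℝ) 1).Nonempty := ⟨(0, 0), by simp⟩
  obtain ⟨s, hs, hsmin⟩ := hcompact.exists_isMinOn hne
    (continuousOn_baseUtility (q := q) (p := p) (γ := γ) hd1)
  obtain ⟨t, ht, htmax⟩ := hcompact.exists_isMaxOn hne
    (continuousOn_baseUtility (q := q) (p := p) (γ := γ) hd1)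
  set bmin := baseUtility q p γ d s.1 s.2 with hbmin
  set bmax := baseUtility q p γ d t.1 t.2 with hbmax
  have hmin : ∀ x ∈ Set.Icc (0 : ℝ) 1, ∀ y ∈ Set.Icc (0 : ℝ) 1, bmin ≤ baseUtility q p γ d x y :=
    fun x hx y hy => hsmin (a := (x, y)) ⟨hx, hy⟩
  have hmax : ∀ x ∈ Set.Icc (0 : ℝ) 1, ∀ y ∈ Set.Icc (0 : ℝ) 1, baseUtility q p γ d x y ≤ bmax :=
    fun x hx y hy => htmax (a := (x, y)) ⟨hx, hy⟩
  have h0 : (0 : ℝ) ∈ Set.Icc (0 : ℝ) 1 := by simp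
  have h1 : (1 : ℝ) ∈ Set.Icc (0 : ℝ) 1 := by simp
  set b := baseUtility q p γ d 0 0 with hb
  have hbb : b ≤ bmax := hmax 0 h0 0 h0
  have hleast : IsLeast {y | ∃ δ₁ ∈ Set.Icc (0 : ℝ) 1, ∃ δ₂ ∈ Set.Icc (0 : ℝ) 1,
      y = poaExpr q p γ d δ₁ δ₂} (extQuot A bmax) := by
    refine ⟨⟨t.1, ht.1, t.2, ht.2, rfl⟩, ?_⟩
    rintro _ ⟨x, hx, y, hy, rfl⟩
    exact extQuot_antitone hA (hmax x hx y hy)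
  have hgreatest : IsGreatest {y | ∃ δ₁ ∈ Set.Icc (0 : ℝ) 1, ∃ δ₂ ∈ Set.Icc (0 : ℝ) 1,
      y = poaExpr q p γ d δ₁ δ₂} (extQuot A bmin) := by
    refine ⟨⟨s.1, hs.1, s.2, hs.2, rfl⟩, ?_⟩
    rintro _ ⟨x, hx, y, hy, rfl⟩
    exact extQuot_antitone hA (hmin x hx y hy)
  -- The equilibria that are almost `d`-regular show that `b` is positive.
  have hbpos : 0 < b := by
    have hlin : ∀ᶠ n : ℕ in atTop, (n : ℝ) * (1 - q) ≤
        (n : ℝ) * b + ((d + 2 : ℕ) : ℝ) * (1 + γ * (d + 1) + |b|) := by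
      filter_upwards [eventually_ge_atTop (3 * d + 4)] with n hn
      obtain ⟨G, hG, hw⟩ := exists_isDFPNE hq hp hp1 hq1.le hγ hd1 hd0 hd hn
      have := hG.card_mul_le_welfare hq hp hp1
      rw [Fintype.card_fin] at this
      linarith [(abs_le.1 hw).2]
    have hlim := tendsto_linear_div_linear b (((d + 2 : ℕ) : ℝ) * (1 + γ * (d + 1) + |b|)) 1 0
      one_ne_zero
    rw [div_one] at hlim
    refine lt_of_lt_of_le (by linarith : 0 < 1 - q) (ge_of_tendsto hlim ?_)
    filter_upwards [hlin, eventually_ge_atTop 1] with n hn hn1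
    have hn0 : (0 : ℝ) < n := by exact_mod_cast hn1
    rw [mul_one, add_zero, le_div_iff₀ hn0]
    linarith
  have hbmaxpos : 0 < bmax := hbpos.trans_le hbb
  have hmeq : extQuot A bmax = ((A / bmax : ℝ) : EReal) := if_pos hbmaxpos
  obtain ⟨K, hK⟩ := PoA_bounds hq hp hp1 hq1 hγ hγ' hd1 hd0 hd
  obtain ⟨C, hC⟩ := exists_le_welfare_of_isDFPNE hq hp hp1 hq1.le hγ hd1 hd0 hd
    (hmin 0 h0 0 h0) (hmin 0 h0 1 h1) (hmin 1 h1 1 h1)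
  have hlow := hK.mono fun n hn => hn.1
  have hlowlim := tendsto_linear_div_linear A (-K) b K hbpos.ne'
  have hml : A / bmax ≤ A / b := div_le_div_of_nonneg_left hA.le hbpos hbb
  by_cases hpos : 0 < bmin
  · have hMeq : extQuot A bmin = ((A / bmin : ℝ) : EReal) := if_pos hpos
    have hup : ∀ᶠ n : ℕ in atTop, PoA n q p γ ≤ ((n : ℝ) * A + 0) / ((n : ℝ) * bmin + -C) := by
      have hlarge : ∀ᶠ n : ℕ in atTop, C / bmin < (n : ℝ) :=
        tendsto_natCast_atTop_atTop.eventually_gt_atTop _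
      filter_upwards [hK, hlarge] with n hn hnC
      rw [div_lt_iff₀ hpos] at hnC
      rw [add_zero]
      exact hn.2 _ (by linarith) fun G hG => by linarith [hC n G hG]
    obtain ⟨e, he, hmem⟩ := exists_tendsto_zero_mem_Icc
      (div_le_div_of_nonneg_left hA.le hpos (hmin t.1 ht.1 t.2 ht.2)) hlow hup hlowlim
      (tendsto_linear_div_linear A 0 bmin (-C) hpos.ne') hml le_rfl
    refine ⟨e, he, Eventually.of_forall fun n => ⟨_, _, hleast, hgreatest, ?_, ?_⟩⟩
    · rw [hmeq, EReal.coe_le_coe_iff]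
      exact (hmem n).1
    · rw [hMeq, EReal.coe_le_coe_iff]
      exact (hmem n).2
  · have hMeq : extQuot A bmin = ⊤ := if_neg hpos
    refine ⟨fun n => max (A / bmax - PoA n q p γ) 0,
      tendsto_max_zero (hlow.mono fun n hn => sub_le_sub_left hn _) (hlowlim.const_sub _)
        (by linarith), Eventually.of_forall fun n => ⟨_, _, hleast, hgreatest, ?_, ?_⟩⟩
    · rw [hmeq, EReal.coe_le_coe_iff]
      linarith [le_max_left (A / bmax - PoA n q p γ) 0]
    · rw [hMeq]
      exact le_top

end PriceOfAnarchy

end ProfessionalNetworking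

theorem mainTheorem3 (q p γ : ℝ) (hq : 0 < q) (hp : 0 < p) (hpq : p + q ≤ 1) :
    (0 < γ → γ ≤ q * p →
      ∃ d : ℕ,
        IsGreatest {k : ℕ | 1 ≤ k ∧ γ / (q * p) ≤ 1 / (k : ℝ) * (1 - p / k) ^ (k - 1)} d ∧
        (∀ᶠ n : ℕ in atTop,
          ∃ G : SimpleGraph (Fin n), ProfessionalNetworking.IsDFPNE q p γ G) ∧
        (∃ e : ℕ → ℝ, Tendsto e atTop (𝓝 0) ∧
          ∀ᶠ n : ℕ in atTop,
            ProfessionalNetworking.EqDelta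
              ((ProfessionalNetworking.PoA n q p γ + e n : ℝ) : EReal)
              (ProfessionalNetworking.poaExpr q p γ d))) ∧
    (q * p < γ → ∀ n : ℕ, 1 ≤ n → ProfessionalNetworking.PoA n q p γ = 1) := by
  have hp1 : p < 1 := by linarith
  have hq1 : q < 1 := by linarith
  have hqp : 0 < q * p := mul_pos hq hp
  refine ⟨fun hγ hγ' => ?_, fun hγ n hn => ProfessionalNetworking.PoA_eq_one hq hp hpq hγ hn⟩
  obtain ⟨d, hd⟩ := ProfessionalNetworking.exists_isGreatest_linkValue hp hp1 (div_pos hγ hqp)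
    ((div_le_one hqp).2 hγ')
  have hd0 : γ ≤ q * p * ProfessionalNetworking.linkValue p d := by
    have := hd.1.2
    rwa [div_le_iff₀ hqp, mul_comm] at this
  have hdlt : ∀ k, d < k → q * p * ProfessionalNetworking.linkValue p k < γ := fun k hk => by
    by_contra! h
    refine absurd (hd.2 ⟨by omega, ?_⟩) (not_le.2 hk)
    rwa [div_le_iff₀ hqp, mul_comm]
  refine ⟨d, hd, ?_, ProfessionalNetworking.exists_eqDelta_PoA hq hp hp1 hq1 hγ hγ' hd.1.1 hd0 hdlt⟩
  filter_upwards [eventually_ge_atTop (3 * d + 4)] with n hn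
  obtain ⟨G, hG, -⟩ := ProfessionalNetworking.exists_isDFPNE hq hp hp1 hq1.le hγ hd.1.1 hd0 hdlt hn
  exact ⟨G, hG⟩
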